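/- Let $(M,g)$ be an oriented smooth Riemannian manifold of dimension 8. A positive orthogonal almost complex structure is an endomorphism $J$ of a tangent space that is $g$-orthogonal, satisfies $J^2=-\mathrm{Id}$ and induces the given orientation; put $\omega_J(u,v)=g(Ju,v)$. A hyper-Kähler triple at $p\in M$ is a triple $(J_1,J_2,J_3)$ of positive orthogonal complex structures of $T_pM$ with $J_1J_2=-J_2J_1=J_3$, and $\mathcal T(M)_p\subset\Lambda^4T_p^*M$ is the set of the 4-forms $\frac16\sum_{i=1}^3\omega_{J_i}\wedge\omega_{J_i}$ of all such triples. An almost quaternionic Hermitian structure $Q$ on $M$ is given by a rank 3 bundle $E\subset\mathrm{End}(TM)$ that is locally spanned by smooth fields of hyper-Kähler triples $(J_1,J_2,J_3)$; its fundamental 4-form is $\Omega=\frac16\sum_{i}\omega_{J_i}\wedge\omega_{J_i}$, which does not depend on the triple. Let $\langle\cdot,\cdot\rangle$ be the inner product on 4-forms for which the forms $e^{i_1}\wedge e^{i_2}\wedge e^{i_3}\wedge e^{i_4}$, $i_1<i_2<i_3<i_4$, of an orthonormal coframe are orthonormal, and let $\Lambda^4_+(TM)$ be the bundle of self-dual 4-forms.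 **Proposition 11.3.** Let $Q_0,Q_1$ be two almost quaternionic Hermitian structures on $(M,g)$, with bundles $E_0,E_1$ and fundamental 4-forms $\Omega_0,\Omega_1$, and let $\theta(p)\in[0,\pi]$ be the angle with $\cos\theta(p)=\frac3{10}\langle\Omega_0(p),\Omega_1(p)\rangle$. 1. If $\dim(E_0\cap E_1)_p\ge 1$ for all $p\in M$, then $\Omega_0$ and $\Omega_1$ are homotopic in $\Lambda^4_+(TM)$ through self-dual 4-forms of constant norm: there is a family $\Omega_t$, $t\in[0,1]$, of self-dual 4-forms on $M$, smooth in $(p,t)\in M\times[0,1]$, joining $\Omega_0$ to $\Omega_1$, with $\langle\Omega_t,\Omega_t\rangle=\frac{10}3$ everywhere. 2. If $\dim(E_0\cap E_1)_p=1$ and $\cos\theta(p)>\frac7{15}$ for all $p\in M$, then $\Omega_0$ and $\Omega_1$ are locally homotopic in $\mathcal T(M)$: every point of $M$ has an open neighbourhood $U$ on which there is a family $\Omega_t$, $t\in[0,1]$, of 4-forms, smooth in $(p,t)\in U\times[0,1]$, joining $\Omega_0|_U$ to $\Omega_1|_U$, with $\Omega_t(p)\in\mathcal T(M)_p$ for all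 $t\in[0,1]$ and $p\in U$. -/

import Mathlib

open scoped Manifold ContDiff Bundle
open Bundle

noncomputable section

/-! ## Linear algebra of an oriented Euclidean 8-space -/

section LinearAlgebra

variable {V : Type*} [NormedAddCommGroup V] [InnerProductSpace ℝ V]

/-- The product `β(v₀, v₁) γ(v₂, v₃)` of two bilinear forms, as a 4-linear form. -/
def bilinProd (β γ : V →ₗ[ℝ] V →ₗ[ℝ] ℝ) : MultilinearMap ℝ (fun _ : Fin 4 => V) ℝ where
  toFun v := β (v 0) (v 1) * γ (v 2) (v 3)
  map_update_add' := by
    intro inst v i x y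
    obtain rfl : inst = instDecidableEqFin 4 := Subsingleton.elim _ _
    fin_cases i <;> simp <;> ring
  map_update_smul' := by
    intro inst v i c x
    obtain rfl : inst = instDecidableEqFin 4 := Subsingleton.elim _ _
    fin_cases i <;> simp <;> ring

/-- The wedge product of two 2-forms, in the convention `(e¹ ∧ e²)(e₁, e₂) = 1`:
`(β ∧ γ)(v₀, v₁, v₂, v₃) = 1/(2! 2!) ∑_σ sign(σ) β(v_{σ0}, v_{σ1}) γ(v_{σ2}, v_{σ3})`. -/
def wedgeTwo (β γ : V →ₗ[ℝ] V →ₗ[ℝ] ℝ) : V [⋀^Fin 4]→ₗ[ℝ] ℝ :=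
  (1 / 4 : ℝ) • MultilinearMap.alternatization (bilinProd β γ)

theorem wedgeTwo_apply (β γ : V →ₗ[ℝ] V →ₗ[ℝ] ℝ) (v : Fin 4 → V) :
   wedgeTwo β γ v = (1/4:ℝ) * ∑ σ : Equiv.Perm (Fin 4), (Equiv.Perm.sign σ : ℤ) *
     (β (v (σ 0)) (v (σ 1)) * γ (v (σ 2)) (v (σ 3))) := by
  simp [wedgeTwo, MultilinearMap.alternatization_apply, bilinProd, Units.smul_def]

/-- The 2-form `ω_J(u, v) = ⟪J u, v⟫` of an endomorphism `J` (it is alternating as soon as `J` is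
an orthogonal complex structure). -/
def kahlerForm (J : V →L[ℝ] V) : V →ₗ[ℝ] V →ₗ[ℝ] ℝ :=
  (innerₗ V).comp J.toLinearMap

/-- `J` is a positive orthogonal complex structure on the oriented Euclidean space `(V, o)`:
a linear isometry with `J² = -1` which induces the orientation `o`, i.e. every basis of the form
`(v₁, J v₁, v₂, J v₂, v₃, J v₃, v₄, J v₄)` is positively oriented. -/
structure IsPosOrthComplexStructure (o : Orientation ℝ V (Fin 8)) (J : V →L[ℝ] V) : Prop where
  isometry : ∀ u v : V, inner ℝ (J u) (J v) = inner ℝ u v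
  sq : ∀ v : V, J (J v) = -v
  positive : ∀ b : Module.Basis (Fin 8) ℝ V,
    b 1 = J (b 0) → b 3 = J (b 2) → b 5 = J (b 4) → b 7 = J (b 6) → b.orientation = o

/-- `(J 0, J 1, J 2)` is a hyper-Kähler triple `(J₁, J₂, J₃ = J₁ J₂)` on `(V, o)`: positive
orthogonal complex structures satisfying the quaternionic relations. -/
structure IsHKTriple (o : Orientation ℝ V (Fin 8)) (J : Fin 3 → V →L[ℝ] V) : Prop where
  complex : ∀ i, IsPosOrthComplexStructure o (J i)
  anticomm : ∀ v : V, J 0 (J 1 v) = -J 1 (J 0 v)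
  mul : ∀ v : V, J 2 v = J 0 (J 1 v)

/-- The fundamental 4-form `Ω = (1/6) (ω₁ ∧ ω₁ + ω₂ ∧ ω₂ + ω₃ ∧ ω₃)` of a triple. -/
def hkForm (J : Fin 3 → V →L[ℝ] V) : V [⋀^Fin 4]→ₗ[ℝ] ℝ :=
  (1 / 6 : ℝ) • ∑ i, wedgeTwo (kahlerForm (J i)) (kahlerForm (J i))

theorem IsHKTriple.inner_eq {o : Orientation ℝ V (Fin 8)} {J : Fin 3 → V →L[ℝ] V}
    (h : IsHKTriple o J) (i k : Fin 3) (u : V) :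
    inner ℝ (J i u) (J k u) = if i = k then inner ℝ u u else 0 := by
  have skew : ∀ i u v, inner ℝ (J i u) v = - inner ℝ u (J i v) := by
    intro i u v
    have := (h.complex i).isometry u (J i v)
    rw [(h.complex i).sq, inner_neg_right] at this
    linarith
  have z : ∀ i u, inner ℝ (J i u) u = (0:ℝ) := by
    intro i u
    have := skew i u u
    rw [real_inner_comm u (J i u)] at this
    rw [real_inner_comm]; linarith
  have h01 : inner ℝ (J 0 u) (J 1 u) = (0:ℝ) := by
    rw [skew, ← h.mul, real_inner_comm, z, neg_zero]
  have h02 : inner ℝ (J 0 u) (J 2 u) = (0:ℝ) := by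
    rw [h.mul, (h.complex 0).isometry, real_inner_comm, z]
  have h12 : inner ℝ (J 1 u) (J 2 u) = (0:ℝ) := by
    rw [h.mul, h.anticomm, inner_neg_right, (h.complex 1).isometry, real_inner_comm, z]; simp
  have a := fun i => (h.complex i).isometry u u
  have h10 := (real_inner_comm (J 0 u) (J 1 u)).trans h01
  have h20 := (real_inner_comm (J 0 u) (J 2 u)).trans h02
  have h21 := (real_inner_comm (J 1 u) (J 2 u)).trans h12
  fin_cases i <;> fin_cases k
  exacts [a 0, h01, h02, h10, a 1, h12, h20, h21, a 2]

/-- The fundamental 4-form depends only on the span of the triple. -/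
theorem hkForm_eq_of_span_eq {o : Orientation ℝ V (Fin 8)} {J J' : Fin 3 → V →L[ℝ] V}
    (h : IsHKTriple o J) (h' : IsHKTriple o J')
    (hs : Submodule.span ℝ (Set.range J') = Submodule.span ℝ (Set.range J)) :
    hkForm J' = hkForm J := by
  have hmem : ∀ i, ∃ c : Fin 3 → ℝ, ∑ j, c j • J j = J' i := by
    intro i
    rw [← Submodule.mem_span_range_iff_exists_fun, ← hs]
    exact Submodule.subset_span ⟨i, rfl⟩
  choose a ha using hmem
  have hV : ∃ u : V, u ≠ 0 ∨ ∀ v : V, v = 0 := by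
    by_cases hh : ∃ u : V, u ≠ 0
    · exact ⟨hh.choose, Or.inl hh.choose_spec⟩
    · push Not at hh; exact ⟨0, Or.inr hh⟩
  obtain ⟨u, hu | h0⟩ := hV
  swap
  · ext v
    rw [show v = 0 from funext fun i => h0 _]
    simp
  have hu' : inner ℝ u u ≠ (0:ℝ) := by simpa using hu
  let A : Matrix (Fin 3) (Fin 3) ℝ := Matrix.of a
  have hA : A * A.transpose = 1 := by
    ext i k
    have := h'.inner_eq i k u
    rw [← ha, ← ha] at this
    simp only [sum_apply, smul_apply, sum_inner, inner_sum,
      inner_smul_left, inner_smul_right, h.inner_eq] at this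
    simp only [Matrix.mul_apply, Matrix.transpose_apply, Matrix.one_apply, A, Matrix.of_apply]
    simp at this
    apply mul_right_cancel₀ hu'
    rw [Finset.sum_mul]
    convert this using 1
    · refine Finset.sum_congr rfl fun x _ => ?_
      simp; ring
    · split_ifs <;> simp
  have hA' := mul_eq_one_comm.mp hA
  have e : ∀ j k, ∑ i, a i j * a i k = if j = k then 1 else 0 := by
    intro j k
    have := congrFun (congrFun hA' j) k
    simpa [Matrix.mul_apply, Matrix.one_apply, A] using this
  have key : ∀ p q r s : V, ∑ i, kahlerForm (J' i) p q * kahlerForm (J' i) r s =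
      ∑ i, kahlerForm (J i) p q * kahlerForm (J i) r s := by
    intro p q r s
    have hk : ∀ i p q, kahlerForm (J' i) p q = ∑ j, a i j * kahlerForm (J j) p q := by
      intro i p q
      simp [kahlerForm, ← ha]
    simp only [hk, Fin.sum_univ_three] at e ⊢
    have e00 := e 0 0; have e01 := e 0 1; have e02 := e 0 2
    have e11 := e 1 1; have e12 := e 1 2; have e22 := e 2 2
    simp at e00 e01 e02 e11 e12 e22
    linear_combination (kahlerForm (J 0) p q * kahlerForm (J 0) r s) * e00 +
      (kahlerForm (J 1) p q * kahlerForm (J 1) r s) * e11 +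
      (kahlerForm (J 2) p q * kahlerForm (J 2) r s) * e22 +
      (kahlerForm (J 0) p q * kahlerForm (J 1) r s + kahlerForm (J 1) p q * kahlerForm (J 0) r s) * e01 +
      (kahlerForm (J 0) p q * kahlerForm (J 2) r s + kahlerForm (J 2) p q * kahlerForm (J 0) r s) * e02 +
      (kahlerForm (J 1) p q * kahlerForm (J 2) r s + kahlerForm (J 2) p q * kahlerForm (J 1) r s) * e12
  ext v
  simp only [hkForm, AlternatingMap.smul_apply, Fin.sum_univ_three, AlternatingMap.add_apply,
    wedgeTwo_apply, ← mul_add, ← Finset.sum_add_distrib]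
  congr 2
  refine Finset.sum_congr rfl fun σ _ => ?_
  have := key (v (σ 0)) (v (σ 1)) (v (σ 2)) (v (σ 3))
  simp only [Fin.sum_univ_three] at this
  rw [this]

/-- The set `𝒯` of fundamental 4-forms of hyper-Kähler triples of `(V, o)`. -/
def hkForms (o : Orientation ℝ V (Fin 8)) : Set (V [⋀^Fin 4]→ₗ[ℝ] ℝ) :=
  {Ω | ∃ J : Fin 3 → V →L[ℝ] V, IsHKTriple o J ∧ Ω = hkForm J}

/-- The 4-form `α` is self-dual, `⋆α = α`. The Hodge star in dimension 8 is characterized by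
`(⋆α)(e₅, e₆, e₇, e₈) = α(e₁, e₂, e₃, e₄)` for all positive orthonormal bases `(e₁, …, e₈)`. -/
def IsSelfDual (o : Orientation ℝ V (Fin 8)) (α : V [⋀^Fin 4]→ₗ[ℝ] ℝ) : Prop :=
  ∀ e : OrthonormalBasis (Fin 8) ℝ V, e.toBasis.orientation = o →
    α ![e 4, e 5, e 6, e 7] = α ![e 0, e 1, e 2, e 3]

/-- The inner product of 4-forms for which the forms `e^{i₁} ∧ e^{i₂} ∧ e^{i₃} ∧ e^{i₄}`,
`i₁ < i₂ < i₃ < i₄`, are orthonormal, for an orthonormal basis `e` (any one of them). -/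
def formInner [FiniteDimensional ℝ V] (α β : V [⋀^Fin 4]→ₗ[ℝ] ℝ) : ℝ :=
  (1 / 24 : ℝ) * ∑ i : Fin 4 → Fin (Module.finrank ℝ V),
    α (fun k => stdOrthonormalBasis ℝ V (i k)) * β (fun k => stdOrthonormalBasis ℝ V (i k))

end LinearAlgebra

/-! ## Manifolds of dimension 8 -/

section Manifold

variable (M : Type*) [TopologicalSpace M] [ChartedSpace (EuclideanSpace ℝ (Fin 8)) M]

instance tangentSpace_finiteDimensional (p : M) : FiniteDimensional ℝ (TangentSpace (𝓡 8) p) :=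
  inferInstanceAs (FiniteDimensional ℝ (EuclideanSpace ℝ (Fin 8)))

/-- A field of 4-forms on `M`, without regularity. -/
abbrev FourFormField : Type _ := ∀ p : M, (TangentSpace (𝓡 8) p) [⋀^Fin 4]→ₗ[ℝ] ℝ

variable [IsManifold (𝓡 8) ∞ M]

/-- The vector field `X` is smooth on `U`. -/
def SmoothVectorFieldOn (U : Set M) (X : ∀ p : M, TangentSpace (𝓡 8) p) : Prop :=
  ContMDiffOn (𝓡 8) (𝓡 8).tangent ∞ (fun p => (⟨p, X p⟩ : TangentBundle (𝓡 8) M)) U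

/-- The field `J` of endomorphisms of the tangent spaces is smooth on `U`. -/
def SmoothEndFieldOn (U : Set M)
    (J : ∀ p : M, TangentSpace (𝓡 8) p →L[ℝ] TangentSpace (𝓡 8) p) : Prop :=
  ContMDiffOn (𝓡 8) ((𝓡 8).prod 𝓘(ℝ, EuclideanSpace ℝ (Fin 8) →L[ℝ] EuclideanSpace ℝ (Fin 8))) ∞
    (fun p => TotalSpace.mk' (EuclideanSpace ℝ (Fin 8) →L[ℝ] EuclideanSpace ℝ (Fin 8))
      (E := fun p : M => TangentSpace (𝓡 8) p →L[ℝ] TangentSpace (𝓡 8) p) p (J p)) U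

/-- The one-parameter family `Ω t`, `t ∈ [0,1]`, of fields of 4-forms is smooth in
`(p, t) ∈ U × [0,1]`: its values on smooth vector fields of open subsets of `U` are smooth
functions of `(p, t)`. -/
def SmoothFormFamilyOn (U : Set M) (Ω : ℝ → FourFormField M) : Prop :=
  ∀ W : Set M, IsOpen W → W ⊆ U → ∀ X : Fin 4 → ∀ p : M, TangentSpace (𝓡 8) p,
    (∀ i, SmoothVectorFieldOn M W (X i)) →
    ContMDiffOn ((𝓡 8).prod 𝓘(ℝ, ℝ)) 𝓘(ℝ, ℝ) ∞
      (fun x : M × ℝ => Ω x.2 x.1 (fun i => X i x.1)) (W ×ˢ Set.Icc (0 : ℝ) 1)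

/-- An orientation of `M`: orientations of the tangent spaces for which there are positive smooth
frames near every point. -/
structure ManifoldOrientation where
  or : ∀ p : M, Orientation ℝ (TangentSpace (𝓡 8) p) (Fin 8)
  exists_frame : ∀ p₀ : M, ∃ U : Set M, IsOpen U ∧ p₀ ∈ U ∧
    ∃ X : Fin 8 → ∀ p : M, TangentSpace (𝓡 8) p, (∀ i, SmoothVectorFieldOn M U (X i)) ∧
      ∀ p ∈ U, ∃ b : Module.Basis (Fin 8) ℝ (TangentSpace (𝓡 8) p),
        (∀ i, b i = X i p) ∧ b.orientation = or p

variable {M}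
variable [RiemannianBundle (fun p : M => TangentSpace (𝓡 8) p)]

/-- An almost quaternionic Hermitian structure on the oriented Riemannian 8-manifold `M`, given
by its rank 3 bundle `E ⊆ End(TM)`, which is locally spanned by smooth triples
`(J₁, J₂, J₃ = J₁ J₂)` of positive orthogonal almost complex structures with `J₁ J₂ = - J₂ J₁`. -/
structure AQHStructure (o : ManifoldOrientation M) where
  E : ∀ p : M, Submodule ℝ (TangentSpace (𝓡 8) p →L[ℝ] TangentSpace (𝓡 8) p)
  exists_local_triple : ∀ p₀ : M, ∃ U : Set M, IsOpen U ∧ p₀ ∈ U ∧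
    ∃ J : Fin 3 → ∀ p : M, TangentSpace (𝓡 8) p →L[ℝ] TangentSpace (𝓡 8) p,
      (∀ i, SmoothEndFieldOn M U (J i)) ∧
      ∀ p ∈ U, IsHKTriple (o.or p) (fun i => J i p) ∧
        E p = Submodule.span ℝ (Set.range fun i => J i p)

namespace AQHStructure

variable {o : ManifoldOrientation M}

theorem exists_triple (Q : AQHStructure o) (p : M) :
    ∃ J : Fin 3 → TangentSpace (𝓡 8) p →L[ℝ] TangentSpace (𝓡 8) p,
      IsHKTriple (o.or p) J ∧ Q.E p = Submodule.span ℝ (Set.range J) := by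
  obtain ⟨U, -, hp, J, -, h⟩ := Q.exists_local_triple p
  exact ⟨fun i => J i p, h p hp⟩

/-- The fundamental 4-form of an almost quaternionic Hermitian structure: at each point, the form
`(1/6) ∑ ω_i ∧ ω_i` of any hyper-Kähler triple spanning `E p`. -/
def fundamentalForm (Q : AQHStructure o) : FourFormField M :=
  fun p => hkForm (Q.exists_triple p).choose

theorem fundamentalForm_eq (Q : AQHStructure o) (p : M)
    {J : Fin 3 → TangentSpace (𝓡 8) p →L[ℝ] TangentSpace (𝓡 8) p}
    (h : IsHKTriple (o.or p) J) (hJ : Q.E p = Submodule.span ℝ (Set.range J)) :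
    Q.fundamentalForm p = hkForm J :=
  hkForm_eq_of_span_eq h (Q.exists_triple p).choose_spec.1
    ((Q.exists_triple p).choose_spec.2.symm.trans hJ)

/-- The angle `θ ∈ [0, π]` between two almost quaternionic Hermitian structures,
`cos θ = (3/10) ⟨Ω₀, Ω₁⟩`. -/
def angle (Q₀ Q₁ : AQHStructure o) (p : M) : ℝ :=
  Real.arccos (3 / 10 * formInner (Q₀.fundamentalForm p) (Q₁.fundamentalForm p))

end AQHStructure

end Manifold

end

/-! Endomorphisms carry the form `endInner`, -tr(αβ)/8, for which hyper-Kähler triples are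
orthonormal; the unit elements of their span are positive complex structures. For skew α, β the
product of ω_α ∧ ω_α and ω_β ∧ ω_β is tr(αβ)²/2 - tr(αβαβ) (`formInner_wedgeTwo`). If the two spans
share a unit element I, complete it to triples (I, K, IK) and (I, L, IL). The quartic traces then
cancel and ⟨Ω₀, Ω₁⟩ = (14 + 16c²)/9 with c² = ⟨K, L⟩² + ⟨K, IL⟩² (`formInner_hkForm_of_common`).
This c², called `hkCosSq`, is the squared length of the projection of K to E₁ and does not depend on
the choices.

Self-dual homotopy: the inner product is positive, so the segment from Ω₀ to Ω₁ never vanishes and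
can be rescaled to constant norm. Self-duality is linear, and reduces to that of ω_J ∧ ω_J for
positive J. Up to a factor this 4-form is the volume form contracted twice with the bivector of J,
an expression independent of the orthonormal basis.

Homotopy in 𝒯(M): since cos θ = 7/15 + (8/15)c², the hypothesis on θ means c² > 0. Take a unit K in
E₀ orthogonal to I, and let L be its normalized projection to E₁. Then ⟨K, L⟩ > 0 and ⟨K, IL⟩ = 0. A
Cayley-Hamilton argument for quaternionic Hermitian endomorphisms of ℍ² forces KL + LK to be a
scalar (`IsQuatPair.anticommutator_eq`). Hence the normalized segment γ from K to L consists of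
complex structures anticommuting with I, and the triples (I, γ, Iγ) give the path
(`IsCommonFrame.path`).

Smooth choice of I and K: projecting from E₀ to E₁ and back is the identity on I and multiplication
by c² on the complement of I in E₀. As the intersection is a line, c² ≠ 1, so subtracting c²
isolates a multiple of I by a smooth formula (`commonPart`); K follows by orthogonalization. -/

noncomputable section

/-! ### Traces of endomorphisms and inner products of 4-forms -/

section TraceForm

variable {V : Type*} [NormedAddCommGroup V] [InnerProductSpace ℝ V]

/-- The trace of a continuous endomorphism. -/
def endTrace : (V →L[ℝ] V) →ₗ[ℝ] ℝ :=
  (LinearMap.trace ℝ V).comp (ContinuousLinearMap.coeLM ℝ)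

theorem endTrace_mul_comm (α β : V →L[ℝ] V) : endTrace (α * β) = endTrace (β * α) :=
  LinearMap.trace_mul_comm ℝ α.toLinearMap β.toLinearMap

theorem endTrace_eq_sum {ι : Type*} [Fintype ι] (e : OrthonormalBasis ι ℝ V) (α : V →L[ℝ] V) :
    endTrace α = ∑ i, inner ℝ (e i) (α (e i)) :=
  LinearMap.trace_eq_sum_inner α.toLinearMap e

theorem endTrace_one [FiniteDimensional ℝ V] :
    endTrace (1 : V →L[ℝ] V) = Module.finrank ℝ V :=
  LinearMap.trace_one ℝ V

/-- A permutation is a transposition (0 p), with p the image of 0, after a permutation of the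
nonzero indices; the transposition contributes the sign -1 unless p = 0. -/
theorem sum_perm_fin_succ {n : ℕ} {R : Type*} [CommRing R] (f : (Fin (n+1) → Fin (n+1)) → R) :
    ∑ σ : Equiv.Perm (Fin (n+1)), ((Equiv.Perm.sign σ : ℤ) : R) * f σ =
    ∑ p : Fin (n+1), (if p = 0 then 1 else -1) * ∑ σ : Equiv.Perm (Fin n), ((Equiv.Perm.sign σ : ℤ) : R) * f (Fin.cons p (fun i => Equiv.swap 0 p (σ i).succ)) := by
  rw [← Equiv.sum_comp Equiv.Perm.decomposeFin.symm, Fintype.sum_prod_type]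
  refine Finset.sum_congr rfl fun p _ => ?_
  rw [Finset.mul_sum]
  refine Finset.sum_congr rfl fun σ _ => ?_
  rw [Equiv.Perm.decomposeFin.symm_sign]
  have : (⇑(Equiv.Perm.decomposeFin.symm (p, σ)) : Fin (n+1) → Fin (n+1)) = (Fin.cons p (fun i => Equiv.swap 0 p (σ i).succ)) := by
    funext i
    refine Fin.cases ?_ (fun i => ?_) i <;> simp
  rw [this]
  split_ifs <;> simp

/-- The recursion on the image of 0, applied from one index up to four. Both the wedge product of
2-forms and the 4 × 4 determinant are sums of this shape. -/
theorem sum_perm_fin_four {R : Type*} [CommRing R] (f : Fin 4 → Fin 4 → Fin 4 → Fin 4 → R) :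
    ∑ σ : Equiv.Perm (Fin 4), ((Equiv.Perm.sign σ : ℤ) : R) * f (σ 0) (σ 1) (σ 2) (σ 3) =
      f 0 1 2 3 - f 0 1 3 2 - f 0 2 1 3 + f 0 2 3 1 + f 0 3 1 2 - f 0 3 2 1
      - f 1 0 2 3 + f 1 0 3 2 + f 1 2 0 3 - f 1 2 3 0 - f 1 3 0 2 + f 1 3 2 0
      + f 2 0 1 3 - f 2 0 3 1 - f 2 1 0 3 + f 2 1 3 0 + f 2 3 0 1 - f 2 3 1 0
      - f 3 0 1 2 + f 3 0 2 1 + f 3 1 0 2 - f 3 1 2 0 - f 3 2 0 1 + f 3 2 1 0 := by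
  have s : ∀ (n : ℕ) (F : Fin (n + 1) → R), ∑ p, (if p = 0 then 1 else -1) * F p =
      F 0 - ∑ p : Fin n, F p.succ := by
    intro n F; simp [Fin.sum_univ_succ, sub_eq_add_neg]
  have e1 : ∀ F : (Fin 1 → Fin 1) → R,
      ∑ σ : Equiv.Perm (Fin 1), ((Equiv.Perm.sign σ : ℤ) : R) * F σ = F id := by
    intro F; simp
  have e2 : ∀ F : (Fin 2 → Fin 2) → R, ∑ σ : Equiv.Perm (Fin 2),
      ((Equiv.Perm.sign σ : ℤ) : R) * F σ = F ![0, 1] - F ![1, 0] := by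
    intro F
    have a := fun p : Fin 2 => e1 (fun g => F (Fin.cons p (fun i => Equiv.swap 0 p (g i).succ)))
    rw [sum_perm_fin_succ, s]
    simp only [a]
    rw [Finset.univ_unique, Finset.sum_singleton]
    congr 2 <;> decide
  have e3 : ∀ F : (Fin 3 → Fin 3) → R, ∑ σ : Equiv.Perm (Fin 3),
      ((Equiv.Perm.sign σ : ℤ) : R) * F σ = F ![0, 1, 2] - F ![0, 2, 1] -
        ((F ![1, 0, 2] - F ![1, 2, 0]) + (F ![2, 1, 0] - F ![2, 0, 1])) := by
    intro F
    have a := fun p : Fin 3 => e2 (fun g => F (Fin.cons p (fun i => Equiv.swap 0 p (g i).succ)))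
    rw [sum_perm_fin_succ, s]
    simp only [a, Fin.sum_univ_two]
    congr 1
    · congr 2 <;> decide
    · congr 2 <;> congr 2 <;> decide
  have a := fun p : Fin 4 => e3 (fun g => f (Fin.cons (α := fun _ => Fin 4) p
      (fun i => Equiv.swap 0 p (g i).succ) 0)
    (Fin.cons (α := fun _ => Fin 4) p (fun i => Equiv.swap 0 p (g i).succ) 1)
    (Fin.cons (α := fun _ => Fin 4) p (fun i => Equiv.swap 0 p (g i).succ) 2)
    (Fin.cons (α := fun _ => Fin 4) p (fun i => Equiv.swap 0 p (g i).succ) 3))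
  rw [sum_perm_fin_succ (fun g => f (g 0) (g 1) (g 2) (g 3)), s]
  simp only [a, Fin.sum_univ_three]
  trans (f 0 1 2 3 - f 0 1 3 2 - ((f 0 2 1 3 - f 0 2 3 1) + (f 0 3 2 1 - f 0 3 1 2))) -
    ((f 1 0 2 3 - f 1 0 3 2 - ((f 1 2 0 3 - f 1 2 3 0) + (f 1 3 2 0 - f 1 3 0 2))) +
    (f 2 1 0 3 - f 2 1 3 0 - ((f 2 0 1 3 - f 2 0 3 1) + (f 2 3 0 1 - f 2 3 1 0))) +
    (f 3 1 2 0 - f 3 1 0 2 - ((f 3 2 1 0 - f 3 2 0 1) + (f 3 0 2 1 - f 3 0 1 2))))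
  · rfl
  · ring

/-- `α` is skew-symmetric. -/
def IsSkewEnd (α : V →L[ℝ] V) : Prop := ∀ u v, inner ℝ (α u) v = -inner ℝ u (α v)

/-- Skewness groups the 24 terms by the three pairings of four indices, eight equal terms for each;
the factor is 8/4 = 2. -/
theorem wedgeTwo_kahlerForm_apply {α : V →L[ℝ] V} (hα : IsSkewEnd α) (v : Fin 4 → V) :
    wedgeTwo (kahlerForm α) (kahlerForm α) v =
      2 * (inner ℝ (α (v 0)) (v 1) * inner ℝ (α (v 2)) (v 3)
        - inner ℝ (α (v 0)) (v 2) * inner ℝ (α (v 1)) (v 3)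
        + inner ℝ (α (v 0)) (v 3) * inner ℝ (α (v 1)) (v 2)) := by
  have key : ∀ u w, inner ℝ (α u) w = - inner ℝ (α w) u := fun u w => by
    rw [hα, real_inner_comm]
  rw [wedgeTwo_apply, sum_perm_fin_four (fun a b c d =>
    kahlerForm α (v a) (v b) * kahlerForm α (v c) (v d))]
  simp only [kahlerForm, LinearMap.comp_apply, innerₗ_apply_apply, ContinuousLinearMap.coe_coe]
  rw [key (v 1) (v 0), key (v 2) (v 0), key (v 3) (v 0), key (v 2) (v 1), key (v 3) (v 1),
    key (v 3) (v 2)]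
  ring

theorem sum_fin_four_fun {n : ℕ} (f : Fin n → Fin n → Fin n → Fin n → ℝ) :
    ∑ i : Fin 4 → Fin n, f (i 0) (i 1) (i 2) (i 3) = ∑ a, ∑ b, ∑ c, ∑ d, f a b c d := by
  have h := fun (m : ℕ) (F : (Fin (m + 1) → Fin n) → ℝ) =>
    (Equiv.sum_comp (Fin.consEquiv (fun _ : Fin (m + 1) => Fin n)) F).symm
  simp only [h, Fintype.sum_prod_type]
  simp
  rfl

/-- Each factor is a sum over the three pairings of four indices, so there are nine products. Equal
pairings contract to tr(αβ)²; distinct ones contract to a closed cycle, and each of the six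
contributes -tr(αβαβ) once its sign is counted. -/
theorem formInner_wedgeTwo [FiniteDimensional ℝ V] {α β : V →L[ℝ] V} (hα : IsSkewEnd α)
    (hβ : IsSkewEnd β) :
    formInner (wedgeTwo (kahlerForm α) (kahlerForm α)) (wedgeTwo (kahlerForm β) (kahlerForm β)) =
      1 / 2 * endTrace (α * β) ^ 2 - endTrace (α * β * (α * β)) := by
  set e := stdOrthonormalBasis ℝ V
  set A : Matrix _ _ ℝ := LinearMap.toMatrix e.toBasis e.toBasis α.toLinearMap with hA
  set B : Matrix _ _ ℝ := LinearMap.toMatrix e.toBasis e.toBasis β.toLinearMap with hB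
  have hAa : ∀ i j, inner ℝ (α (e i)) (e j) = A j i := by
    intro i j
    simp [hA, LinearMap.toMatrix_apply, e.repr_apply_apply, real_inner_comm]
  have hBa : ∀ i j, inner ℝ (β (e i)) (e j) = B j i := by
    intro i j
    simp [hB, LinearMap.toMatrix_apply, e.repr_apply_apply, real_inner_comm]
  have hAs : ∀ i j, A i j = - A j i := fun i j => by
    rw [← hAa, ← hAa, hα, real_inner_comm]
  have hBs : ∀ i j, B i j = - B j i := fun i j => by
    rw [← hBa, ← hBa, hβ, real_inner_comm]
  have h1 : endTrace (α * β) = ∑ i, ∑ j, A i j * B j i := by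
    have : endTrace (α * β) = (A * B).trace := by
      rw [hA, hB, ← LinearMap.toMatrix_mul, ← LinearMap.trace_eq_matrix_trace]; rfl
    simp [this, Matrix.trace, Matrix.mul_apply]
  have h2 : endTrace (α * β * (α * β)) = ∑ i, ∑ j, ∑ k, ∑ l, A i j * B j k * A k l * B l i := by
    have : endTrace (α * β * (α * β)) = (A * B * A * B).trace := by
      rw [Matrix.mul_assoc, hA, hB, ← LinearMap.toMatrix_mul, ← LinearMap.toMatrix_mul,
        ← LinearMap.trace_eq_matrix_trace]; rfl
    rw [this]
    simp only [Matrix.trace, Matrix.mul_apply, Matrix.diag, Finset.sum_mul]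
    refine Finset.sum_congr rfl fun i _ => ?_
    trans ∑ l, ∑ j, ∑ k, A i j * B j k * A k l * B l i
    · exact Finset.sum_congr rfl fun l _ => Finset.sum_comm
    · rw [Finset.sum_comm]
      exact Finset.sum_congr rfl fun l _ => Finset.sum_comm
  -- The three exchanges of neighbouring summation indices; with the skewness of A and B they reduce
  -- every product of pairings to `D` or `X`.
  have r1 : ∀ g : _ → _ → _ → _ → ℝ, ∑ a, ∑ b, ∑ c, ∑ d, g a b c d =
      ∑ a : Fin (Module.finrank ℝ V), ∑ b : Fin (Module.finrank ℝ V),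
        ∑ c : Fin (Module.finrank ℝ V), ∑ d : Fin (Module.finrank ℝ V), g a c b d :=
    fun g => Finset.sum_congr rfl fun a _ => Finset.sum_comm
  have r2 : ∀ g : _ → _ → _ → _ → ℝ, ∑ a, ∑ b, ∑ c, ∑ d, g a b c d =
      ∑ a : Fin (Module.finrank ℝ V), ∑ b : Fin (Module.finrank ℝ V),
        ∑ c : Fin (Module.finrank ℝ V), ∑ d : Fin (Module.finrank ℝ V), g a b d c :=
    fun g => Finset.sum_congr rfl fun a _ => Finset.sum_congr rfl fun b _ => Finset.sum_comm
  have r0 : ∀ g : _ → _ → _ → _ → ℝ, ∑ a, ∑ b, ∑ c, ∑ d, g a b c d =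
      ∑ a : Fin (Module.finrank ℝ V), ∑ b : Fin (Module.finrank ℝ V),
        ∑ c : Fin (Module.finrank ℝ V), ∑ d : Fin (Module.finrank ℝ V), g b a c d :=
    fun g => Finset.sum_comm
  set D := ∑ a, ∑ b, ∑ c, ∑ d, A b a * A d c * (B b a * B d c) with hD
  set X := ∑ a, ∑ b, ∑ c, ∑ d, A b a * A d c * (B c a * B d b) with hX
  have hD' : endTrace (α * β) ^ 2 = D := by
    rw [h1, pow_two, Finset.sum_comm, Finset.sum_mul, hD]
    refine Finset.sum_congr rfl fun a _ => ?_
    rw [Finset.sum_mul]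
    refine Finset.sum_congr rfl fun b _ => ?_
    rw [Finset.mul_sum]
    refine Finset.sum_congr rfl fun c _ => ?_
    rw [Finset.mul_sum]
    refine Finset.sum_congr rfl fun d _ => ?_
    rw [hBs a b, hBs c d]; ring
  have hX' : endTrace (α * β * (α * β)) = X := by
    rw [h2, r0, hX]
    refine Finset.sum_congr rfl fun a _ => Finset.sum_congr rfl fun b _ =>
      Finset.sum_congr rfl fun c _ => Finset.sum_congr rfl fun d _ => ?_
    rw [hBs a c, hAs c d]; ring
  have t22 : ∑ a, ∑ b, ∑ c, ∑ d, A c a * A d b * (B c a * B d b) = D := by rw [r1]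
  have t33 : ∑ a, ∑ b, ∑ c, ∑ d, A d a * A c b * (B d a * B c b) = D := by rw [r2, r1]
  have t21 : ∑ a, ∑ b, ∑ c, ∑ d, A c a * A d b * (B b a * B d c) = X := by rw [r1]
  have t13 : ∑ a, ∑ b, ∑ c, ∑ d, A b a * A d c * (B d a * B c b) = -X := by
    rw [r2, hX]; simp only [← Finset.sum_neg_distrib]
    refine Finset.sum_congr rfl fun a _ => Finset.sum_congr rfl fun b _ =>
      Finset.sum_congr rfl fun c _ => Finset.sum_congr rfl fun d _ => ?_
    rw [hAs c d]; ring
  have t31 : ∑ a, ∑ b, ∑ c, ∑ d, A d a * A c b * (B b a * B d c) = -X := by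
    rw [r2, r1, hX]; simp only [← Finset.sum_neg_distrib]
    refine Finset.sum_congr rfl fun a _ => Finset.sum_congr rfl fun b _ =>
      Finset.sum_congr rfl fun c _ => Finset.sum_congr rfl fun d _ => ?_
    rw [hBs b d]; ring
  have t23 : ∑ a, ∑ b, ∑ c, ∑ d, A c a * A d b * (B d a * B c b) = X := by
    rw [r1, r2, hX]
    refine Finset.sum_congr rfl fun a _ => Finset.sum_congr rfl fun b _ =>
      Finset.sum_congr rfl fun c _ => Finset.sum_congr rfl fun d _ => ?_
    rw [hBs b d, hAs c d]; ring
  have t32 : ∑ a, ∑ b, ∑ c, ∑ d, A d a * A c b * (B c a * B d b) = X := by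
    rw [r2, r1, r2, hX]
    refine Finset.sum_congr rfl fun a _ => Finset.sum_congr rfl fun b _ =>
      Finset.sum_congr rfl fun c _ => Finset.sum_congr rfl fun d _ => ?_
    rw [hBs b d, hAs c d]; ring
  unfold formInner
  simp only [wedgeTwo_kahlerForm_apply hα, wedgeTwo_kahlerForm_apply hβ]
  rw [sum_fin_four_fun (fun a b c d =>
    2 * (inner ℝ (α (e a)) (e b) * inner ℝ (α (e c)) (e d)
        - inner ℝ (α (e a)) (e c) * inner ℝ (α (e b)) (e d)
        + inner ℝ (α (e a)) (e d) * inner ℝ (α (e b)) (e c)) *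
    (2 * (inner ℝ (β (e a)) (e b) * inner ℝ (β (e c)) (e d)
        - inner ℝ (β (e a)) (e c) * inner ℝ (β (e b)) (e d)
        + inner ℝ (β (e a)) (e d) * inner ℝ (β (e b)) (e c))))]
  simp only [hAa, hBa]
  -- The constant is 2 · 2 / 24: a factor 2 from each wedge square, and 1/24 from `formInner`.
  trans 1 / 6 * ((D - X
      + (∑ a, ∑ b, ∑ c, ∑ d, A b a * A d c * (B d a * B c b)))
      - ((∑ a, ∑ b, ∑ c, ∑ d, A c a * A d b * (B b a * B d c))
      - (∑ a, ∑ b, ∑ c, ∑ d, A c a * A d b * (B c a * B d b))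
      + (∑ a, ∑ b, ∑ c, ∑ d, A c a * A d b * (B d a * B c b)))
      + ((∑ a, ∑ b, ∑ c, ∑ d, A d a * A c b * (B b a * B d c))
      - (∑ a, ∑ b, ∑ c, ∑ d, A d a * A c b * (B c a * B d b))
      + (∑ a, ∑ b, ∑ c, ∑ d, A d a * A c b * (B d a * B c b))))
  · simp only [hD, hX, ← Finset.sum_add_distrib, ← Finset.sum_sub_distrib, Finset.mul_sum]
    refine Finset.sum_congr rfl fun a _ => Finset.sum_congr rfl fun b _ =>
      Finset.sum_congr rfl fun c _ => Finset.sum_congr rfl fun d _ => ?_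
    ring
  · rw [hD', hX', t13, t21, t22, t23, t31, t32, t33]; ring

theorem formInner_smul_left [FiniteDimensional ℝ V] (c : ℝ) (α β : V [⋀^Fin 4]→ₗ[ℝ] ℝ) :
    formInner (c • α) β = c * formInner α β := by
  simp only [formInner, AlternatingMap.smul_apply, smul_eq_mul, mul_assoc, ← Finset.mul_sum]
  ring

theorem formInner_add_left [FiniteDimensional ℝ V] (α α' β : V [⋀^Fin 4]→ₗ[ℝ] ℝ) :
    formInner (α + α') β = formInner α β + formInner α' β := by
  simp only [formInner, AlternatingMap.add_apply, add_mul, Finset.sum_add_distrib]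
  ring

theorem formInner_comm [FiniteDimensional ℝ V] (α β : V [⋀^Fin 4]→ₗ[ℝ] ℝ) :
    formInner α β = formInner β α := by
  simp only [formInner, mul_comm]

theorem formInner_smul_right [FiniteDimensional ℝ V] (c : ℝ) (α β : V [⋀^Fin 4]→ₗ[ℝ] ℝ) :
    formInner α (c • β) = c * formInner α β := by
  rw [formInner_comm, formInner_smul_left, formInner_comm]

theorem formInner_add_right [FiniteDimensional ℝ V] (α β β' : V [⋀^Fin 4]→ₗ[ℝ] ℝ) :
    formInner α (β + β') = formInner α β + formInner α β' := by
  rw [formInner_comm, formInner_add_left, formInner_comm, formInner_comm β']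

theorem formInner_hkForm [FiniteDimensional ℝ V] {J J' : Fin 3 → V →L[ℝ] V}
    (hJ : ∀ i, IsSkewEnd (J i)) (hJ' : ∀ i, IsSkewEnd (J' i)) :
    formInner (hkForm J) (hkForm J') = 1 / 36 * ∑ i, ∑ j,
      (1 / 2 * endTrace (J i * J' j) ^ 2 - endTrace (J i * J' j * (J i * J' j))) := by
  simp only [hkForm, Fin.sum_univ_three, formInner_smul_left, formInner_smul_right,
    formInner_add_left, formInner_add_right, formInner_wedgeTwo (hJ _) (hJ' _)]
  ring

/-- The inner product `-tr(α β) / 8` on skew-symmetric endomorphisms of an 8-dimensional space. -/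
def endInner : (V →L[ℝ] V) →ₗ[ℝ] (V →L[ℝ] V) →ₗ[ℝ] ℝ :=
  LinearMap.mk₂ ℝ (fun α β => -endTrace (α * β) / 8)
    (fun α α' β => by rw [add_mul, map_add]; ring)
    (fun c α β => by rw [smul_mul_assoc, map_smul, smul_eq_mul, smul_eq_mul]; ring)
    (fun α β β' => by rw [mul_add, map_add]; ring)
    (fun c α β => by rw [mul_smul_comm, map_smul, smul_eq_mul, smul_eq_mul]; ring)

theorem endInner_apply (α β : V →L[ℝ] V) : endInner α β = -endTrace (α * β) / 8 := rfl

theorem endInner_comm (α β : V →L[ℝ] V) : endInner α β = endInner β α := by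
  rw [endInner_apply, endInner_apply, endTrace_mul_comm]

theorem endTrace_mul_eq (α β : V →L[ℝ] V) : endTrace (α * β) = -8 * endInner α β := by
  rw [endInner_apply]; ring

theorem IsSkewEnd.endInner_self_nonneg [FiniteDimensional ℝ V] {α : V →L[ℝ] V}
    (hα : IsSkewEnd α) : 0 ≤ endInner α α := by
  rw [endInner_apply, endTrace_eq_sum (stdOrthonormalBasis ℝ V), ← Finset.sum_neg_distrib]
  refine div_nonneg (Finset.sum_nonneg fun i _ => ?_) (by norm_num)
  rw [mul_apply_eq_comp, ← hα]
  exact real_inner_self_nonneg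

theorem IsSkewEnd.eq_zero_of_endInner_self [FiniteDimensional ℝ V] {α : V →L[ℝ] V}
    (hα : IsSkewEnd α) (h : endInner α α = 0) : α = 0 := by
  rw [endInner_apply, endTrace_eq_sum (stdOrthonormalBasis ℝ V), ← Finset.sum_neg_distrib,
    div_eq_zero_iff, or_iff_left (by norm_num), Finset.sum_eq_zero_iff_of_nonneg] at h
  · ext1 v
    have : α.toLinearMap = 0 := by
      refine (stdOrthonormalBasis ℝ V).toBasis.ext fun i => ?_
      have := h i (Finset.mem_univ i)
      rw [mul_apply_eq_comp, ← hα, inner_self_eq_zero] at this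
      simpa using this
    exact congrArg (fun f : V →ₗ[ℝ] V => f v) this
  · intro i _
    rw [mul_apply_eq_comp, ← hα]
    exact real_inner_self_nonneg

theorem IsSkewEnd.add {α β : V →L[ℝ] V} (hα : IsSkewEnd α) (hβ : IsSkewEnd β) :
    IsSkewEnd (α + β) := fun u v => by
  simp only [add_apply, inner_add_left, inner_add_right, hα u v, hβ u v]; ring

theorem IsSkewEnd.smul {α : V →L[ℝ] V} (hα : IsSkewEnd α) (c : ℝ) :
    IsSkewEnd (c • α) := fun u v => by
  simp only [smul_apply, inner_smul_left, inner_smul_right, hα u v]; simp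

theorem IsSkewEnd.sub {α β : V →L[ℝ] V} (hα : IsSkewEnd α) (hβ : IsSkewEnd β) :
    IsSkewEnd (α - β) := fun u v => by
  simp only [sub_apply, inner_sub_left, inner_sub_right, hα u v, hβ u v]; ring

theorem IsSkewEnd.mul_of_anticomm {α β : V →L[ℝ] V} (hα : IsSkewEnd α) (hβ : IsSkewEnd β)
    (h : α * β = -(β * α)) : IsSkewEnd (α * β) := fun u v => by
  rw [mul_apply_eq_comp, hα, hβ, neg_neg, ← mul_apply_eq_comp, h]
  simp

theorem endInner_eq_zero_of_anticomm {α β : V →L[ℝ] V} (h : α * β = -(β * α)) :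
    endInner α β = 0 := by
  have h1 := endInner_comm α β
  rw [endInner_apply, h, map_neg, endInner_apply] at h1
  rw [endInner_apply, h, map_neg]
  linarith

/-- `(I, J)` is a pair of anticommuting orthogonal complex structures. -/
structure IsQuatPair (I J : V →L[ℝ] V) : Prop where
  skew_left : IsSkewEnd I
  skew_right : IsSkewEnd J
  sq_left : I * I = -1
  sq_right : J * J = -1
  anticomm : I * J = -(J * I)

namespace IsQuatPair

variable {I J : V →L[ℝ] V}

theorem symm (h : IsQuatPair I J) : IsQuatPair J I :=
  ⟨h.2, h.1, h.4, h.3, by rw [h.5, neg_neg]⟩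

theorem skew_mul (h : IsQuatPair I J) : IsSkewEnd (I * J) :=
  h.skew_left.mul_of_anticomm h.skew_right h.anticomm

theorem mul_mul_left (h : IsQuatPair I J) : I * (I * J) = -J := by
  rw [← mul_assoc, h.sq_left, neg_one_mul]

theorem mul_mul_right (h : IsQuatPair I J) : I * J * J = -I := by
  rw [mul_assoc, h.sq_right, mul_neg_one]

theorem rotate (h : IsQuatPair I J) : IsQuatPair J (I * J) :=
  ⟨h.skew_right, h.skew_mul, h.sq_right, by
    rw [mul_assoc, ← mul_assoc J, h.symm.anticomm, neg_mul, mul_neg, h.mul_mul_right, mul_neg,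
      neg_neg, h.sq_left], by
    rw [← mul_assoc, h.symm.anticomm, neg_mul]⟩

theorem pair_mul (h : IsQuatPair I J) : IsQuatPair I (I * J) :=
  ⟨h.skew_left, h.skew_mul, h.sq_left, h.rotate.sq_right, by
    rw [h.mul_mul_left, h.anticomm, neg_mul, mul_assoc, h.sq_left, mul_neg_one, neg_neg]⟩

end IsQuatPair

/-- Of the nine pairs, (I, I) contributes 24 and the four anticommuting pairs with exactly one I
contribute 8 each. The other four involve only A = JJ' and IA, each twice up to sign. As I commutes
with A, (IA)² = -A², so the quartic traces cancel and only tr(A)² + tr(IA)² remains. -/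
theorem formInner_hkForm_of_common [FiniteDimensional ℝ V] (hV : Module.finrank ℝ V = 8)
    {I J J' : V →L[ℝ] V} (h : IsQuatPair I J) (h' : IsQuatPair I J') :
    formInner (hkForm ![I, J, I * J]) (hkForm ![I, J', I * J']) =
      (14 + 16 * (endInner J J' ^ 2 + endInner J (I * J') ^ 2)) / 9 := by
  have t1 : endTrace (1 : V →L[ℝ] V) = 8 := by rw [endTrace_one, hV]; norm_num
  have anti : ∀ {α β : V →L[ℝ] V}, IsQuatPair α β →
      1 / 2 * endTrace (α * β) ^ 2 - endTrace (α * β * (α * β)) = 8 := by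
    intro α β k
    rw [endTrace_mul_eq, endInner_eq_zero_of_anticomm k.anticomm, k.rotate.sq_right, map_neg, t1]
    norm_num
  have hII : 1 / 2 * endTrace (I * I) ^ 2 - endTrace (I * I * (I * I)) = 24 := by
    rw [h.sq_left, neg_mul_neg, one_mul, map_neg, t1]; norm_num
  set A := J * J' with hA
  have hIA : I * A = A * I := by
    rw [hA, ← mul_assoc, h.anticomm, neg_mul, mul_assoc, h'.anticomm, mul_neg, neg_neg, mul_assoc]
  have e1 : J * (I * J') = -(I * A) := by
    rw [hA, ← mul_assoc, h.symm.anticomm, neg_mul, mul_assoc]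
  have e2 : I * J * J' = I * A := by rw [mul_assoc]
  have e3 : I * J * (I * J') = A := by
    rw [mul_assoc, e1, mul_neg, ← mul_assoc, h.sq_left, neg_one_mul, neg_neg]
  have e4 : I * A * (I * A) = -(A * A) := by
    rw [mul_assoc, ← mul_assoc A, ← hIA, mul_assoc I A A, ← mul_assoc I I, h.sq_left, neg_one_mul]
  have q1 : endTrace A = -8 * endInner J J' := endTrace_mul_eq _ _
  have q2 : endTrace (I * A) = 8 * endInner J (I * J') := by
    have := endTrace_mul_eq J (I * J')
    rw [e1, map_neg] at this
    linarith
  rw [formInner_hkForm]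
  · simp only [Fin.sum_univ_three, Matrix.cons_val_zero, Matrix.cons_val_one, Matrix.cons_val_two,
      Matrix.head_cons, Matrix.tail_cons]
    rw [hII, anti h', anti h'.pair_mul, anti h.symm, anti h.pair_mul.symm, e1, e2, e3,
      neg_mul_neg, e4, map_neg, map_neg, q1, q2]
    ring
  · intro i; fin_cases i
    exacts [h.skew_left, h.skew_right, h.skew_mul]
  · intro i; fin_cases i
    exacts [h'.skew_left, h'.skew_right, h'.skew_mul]

end TraceForm

/-! ### Positivity of complex structures and quaternionic orthonormal bases -/

section Orientation

variable {V : Type*} [NormedAddCommGroup V] [InnerProductSpace ℝ V]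

/-- A real endomorphism commuting with a complex structure has nonnegative determinant. -/
theorem det_pos_of_commute_complex [FiniteDimensional ℝ V] {J : Module.End ℝ V} (hJ : J * J = -1)
    {T : Module.End ℝ V} (hT : ∀ v, T (J v) = J (T v)) (hdet : LinearMap.det T ≠ 0) :
    0 < LinearMap.det T := by
  -- J makes V a complex vector space on which T is complex linear; its real determinant is then the
  -- squared modulus of its complex determinant.
  let φ : ℂ →ₐ[ℝ] Module.End ℝ V := Complex.lift ⟨J, hJ⟩
  let _ : Module ℂ V := Module.compHom V φ.toRingHom
  have hsmul : ∀ (z : ℂ) (v : V), z • v = z.re • v + z.im • J v := by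
    intro z v
    change φ z v = _
    simp [φ, Complex.lift_apply, Complex.liftAux_apply, Algebra.algebraMap_eq_smul_one]
  have : IsScalarTower ℝ ℂ V := ⟨fun r z v => by
    rw [hsmul, hsmul]; simp [mul_smul, smul_add]⟩
  let T' : V →ₗ[ℂ] V :=
    { toFun := T
      map_add' := T.map_add
      map_smul' := fun z v => by simp [hsmul, hT] }
  have h : T = T'.restrictScalars ℝ := rfl
  have : Module.Finite ℂ V := Module.Finite.right ℝ ℂ V
  rw [h, LinearMap.det_restrictScalars, Algebra.norm_complex_apply] at hdet ⊢
  exact lt_of_le_of_ne (Complex.normSq_nonneg _) hdet.symm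

/-- `b` has the form `(v₁, J v₁, v₂, J v₂, v₃, J v₃, v₄, J v₄)`. -/
def IsComplexBasis (J : V →L[ℝ] V) (b : Module.Basis (Fin 8) ℝ V) : Prop :=
  b 1 = J (b 0) ∧ b 3 = J (b 2) ∧ b 5 = J (b 4) ∧ b 7 = J (b 6)

/-- The change of basis between two such bases commutes with J, hence has positive determinant.
Positivity can therefore be tested on a single basis. -/
theorem IsComplexBasis.orientation_eq {J : V →L[ℝ] V} (hJ : ∀ v, J (J v) = -v)
    {b b' : Module.Basis (Fin 8) ℝ V} (h : IsComplexBasis J b) (h' : IsComplexBasis J b') :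
    b.orientation = b'.orientation := by
  have : FiniteDimensional ℝ V := b.finiteDimensional_of_finite
  obtain ⟨h1, h3, h5, h7⟩ := h
  obtain ⟨k1, k3, k5, k7⟩ := h'
  rw [b.orientation_eq_iff_det_pos]
  let T := b.equiv b' (Equiv.refl _)
  have hT : ∀ i, T (b i) = b' i := fun i => by simp [T]
  have e : b.det b' = LinearMap.det T.toLinearMap := by
    have hc : ⇑b' = ⇑T.toLinearMap ∘ ⇑b := funext fun i => (hT i).symm
    rw [hc, b.det_comp, b.det_self, mul_one]
  rw [e]
  refine det_pos_of_commute_complex (J := J.toLinearMap) (by ext v; simp [hJ]) ?_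
    (LinearEquiv.isUnit_det' T).ne_zero
  have : T.toLinearMap ∘ₗ J.toLinearMap = J.toLinearMap ∘ₗ T.toLinearMap := by
    refine b.ext fun i => ?_
    simp only [LinearMap.comp_apply, LinearEquiv.coe_coe, ContinuousLinearMap.coe_coe]
    fin_cases i <;> simp only [Fin.zero_eta, Fin.mk_one, Fin.reduceFinMk, hT]
    · rw [← h1, hT, k1]
    · rw [h1, hJ, map_neg, hT, k1, hJ]
    · rw [← h3, hT, k3]
    · rw [h3, hJ, map_neg, hT, k3, hJ]
    · rw [← h5, hT, k5]
    · rw [h5, hJ, map_neg, hT, k5, hJ]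
    · rw [← h7, hT, k7]
    · rw [h7, hJ, map_neg, hT, k7, hJ]
  exact fun v => congrArg (fun f : V →ₗ[ℝ] V => f v) this

theorem IsPosOrthComplexStructure.of_basis {o : Orientation ℝ V (Fin 8)} {J : V →L[ℝ] V}
    (hs : IsSkewEnd J) (hJ : J * J = -1) {b : Module.Basis (Fin 8) ℝ V} (hb : IsComplexBasis J b)
    (ho : b.orientation = o) : IsPosOrthComplexStructure o J := by
  have sq : ∀ v, J (J v) = -v := fun v => by
    rw [← mul_apply_eq_comp, hJ]; simp
  refine ⟨fun u v => by rw [hs, sq]; simp, sq, fun b' h1 h3 h5 h7 => ?_⟩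
  rw [← ho]
  exact IsComplexBasis.orientation_eq sq ⟨h1, h3, h5, h7⟩ hb

theorem IsPosOrthComplexStructure.skew {o : Orientation ℝ V (Fin 8)} {J : V →L[ℝ] V}
    (h : IsPosOrthComplexStructure o J) : IsSkewEnd J := fun u v => by
  have := h.isometry u (J v)
  rw [h.sq, inner_neg_right] at this
  linarith

theorem IsPosOrthComplexStructure.mul_self {o : Orientation ℝ V (Fin 8)} {J : V →L[ℝ] V}
    (h : IsPosOrthComplexStructure o J) : J * J = -1 := by
  ext v; simp [h.sq]

theorem IsHKTriple.isQuatPair {o : Orientation ℝ V (Fin 8)} {J : Fin 3 → V →L[ℝ] V}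
    (h : IsHKTriple o J) : IsQuatPair (J 0) (J 1) :=
  ⟨(h.complex 0).skew, (h.complex 1).skew, (h.complex 0).mul_self, (h.complex 1).mul_self, by
    ext v; simp [h.anticomm]⟩

theorem IsHKTriple.eq_mul {o : Orientation ℝ V (Fin 8)} {J : Fin 3 → V →L[ℝ] V}
    (h : IsHKTriple o J) : J 2 = J 0 * J 1 := by
  ext v; simp [h.mul]

theorem IsHKTriple.eq_cons {o : Orientation ℝ V (Fin 8)} {J : Fin 3 → V →L[ℝ] V}
    (h : IsHKTriple o J) : J = ![J 0, J 1, J 0 * J 1] := by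
  ext1 i; fin_cases i
  exacts [rfl, rfl, h.eq_mul]

/-- The orbit of a vector under the basic quaternions. -/
def quatOrbit (I J : V →L[ℝ] V) (v : V) : Fin 4 → V := ![v, I v, J v, I (J v)]

theorem IsQuatPair.inner_quatOrbit {I J : V →L[ℝ] V} (h : IsQuatPair I J) {x y : V}
    (hI : inner ℝ x (I y) = (0 : ℝ)) (hJ : inner ℝ x (J y) = (0 : ℝ))
    (hK : inner ℝ x (I (J y)) = (0 : ℝ)) (i j : Fin 4) :
    inner ℝ (quatOrbit I J x i) (quatOrbit I J y j) = if i = j then inner ℝ x y else 0 := by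
  have sI : ∀ v, I (I v) = -v := fun v => by rw [← mul_apply_eq_comp, h.sq_left]; simp
  have sJ : ∀ v, J (J v) = -v := fun v => by rw [← mul_apply_eq_comp, h.sq_right]; simp
  have sK : ∀ v, J (I v) = -I (J v) := fun v => by
    rw [← mul_apply_eq_comp, h.symm.anticomm]; simp
  fin_cases i <;> fin_cases j <;>
    simp [quatOrbit, h.skew_left _ _, h.skew_right _ _, sI, sJ, sK, hI, hJ, hK]

/-- The quaternionic orbit of v spans at most four dimensions, so a unit vector u orthogonal to it
exists. By skewness the whole orbit of u is orthogonal to that of v. -/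
theorem IsQuatPair.exists_orthonormalBasis [FiniteDimensional ℝ V]
    (hV : Module.finrank ℝ V = 8) {I J : V →L[ℝ] V} (h : IsQuatPair I J) {v : V} (hv : ‖v‖ = 1) :
    ∃ (b : OrthonormalBasis (Fin 8) ℝ V) (u : V),
      ⇑b = ![v, I v, J v, I (J v), u, I u, J u, I (J u)] := by
  have skew0 : ∀ {α : V →L[ℝ] V}, IsSkewEnd α → ∀ x, inner ℝ x (α x) = (0 : ℝ) := by
    intro α hα x
    have := hα x x
    rw [real_inner_comm] at this
    linarith
  have hK : IsSkewEnd (I * J) := h.skew_mul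
  obtain ⟨u, hu, hu1⟩ : ∃ u : V, u ∈ (Submodule.span ℝ (Set.range (quatOrbit I J v)))ᗮ ∧ ‖u‖ = 1 := by
    have h1 := (Submodule.span ℝ (Set.range (quatOrbit I J v))).finrank_add_finrank_orthogonal
    have h2 := finrank_range_le_card (R := ℝ) (quatOrbit I J v)
    rw [Set.finrank] at h2
    have : 0 < Module.finrank ℝ (Submodule.span ℝ (Set.range (quatOrbit I J v)))ᗮ := by
      simp at h2; omega
    obtain ⟨w, hw⟩ := (Module.finrank_pos_iff_exists_ne_zero).1 this
    refine ⟨‖(w : V)‖⁻¹ • w, Submodule.smul_mem _ _ w.2, ?_⟩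
    have : ‖(w : V)‖ ≠ 0 := by simpa using hw
    rw [norm_smul, norm_inv, norm_norm, inv_mul_cancel₀ this]
  rw [Submodule.mem_orthogonal] at hu
  have hu' : ∀ i, inner ℝ (quatOrbit I J v i) u = (0 : ℝ) :=
    fun i => hu _ (Submodule.subset_span ⟨i, rfl⟩)
  have z0 : inner ℝ v u = (0 : ℝ) := hu' 0
  have z1 : inner ℝ v (I u) = (0 : ℝ) := by
    have := hu' 1
    simp only [quatOrbit, Matrix.cons_val_one, Matrix.cons_val_zero, h.skew_left _ _] at this
    linarith
  have z2 : inner ℝ v (J u) = (0 : ℝ) := by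
    have : inner ℝ (J v) u = (0 : ℝ) := hu' 2
    rw [h.skew_right] at this
    linarith
  have z3 : inner ℝ v (I (J u)) = (0 : ℝ) := by
    have : inner ℝ ((I * J) v) u = (0 : ℝ) := hu' 3
    rw [hK] at this
    simpa using this
  have gv := h.inner_quatOrbit (skew0 h.skew_left v) (skew0 h.skew_right v) (skew0 hK v)
  have gu := h.inner_quatOrbit (skew0 h.skew_left u) (skew0 h.skew_right u) (skew0 hK u)
  have gvu := h.inner_quatOrbit z1 z2 z3
  simp only [real_inner_self_eq_norm_sq, hv, hu1, z0] at gv gu gvu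
  have ho : Orthonormal ℝ (fun p : Fin 2 × Fin 4 => quatOrbit I J (![v, u] p.1) p.2) := by
    rw [orthonormal_iff_ite]
    rintro ⟨a, i⟩ ⟨b, j⟩
    fin_cases a <;> fin_cases b
    · simpa using gv i j
    · simpa using gvu i j
    · simpa [real_inner_comm] using gvu j i
    · simpa using gu i j
  have ho' := ho.comp (finProdFinEquiv (m := 2) (n := 4)).symm (Equiv.injective _)
  let b := basisOfOrthonormalOfCardEqFinrank ho' (by simp [hV])
  have hb : ⇑b = _ := coe_basisOfOrthonormalOfCardEqFinrank ho' (by simp [hV])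
  refine ⟨b.toOrthonormalBasis (by rw [hb]; exact ho'), u, ?_⟩
  rw [Module.Basis.coe_toOrthonormalBasis, hb]
  ext1 i
  fin_cases i <;> rfl

theorem Module.Basis.orientation_reindex_perm {n : ℕ} (b : Module.Basis (Fin n) ℝ V)
    (σ : Equiv.Perm (Fin n)) (hσ : Equiv.Perm.sign σ = 1) :
    (b.reindex σ).orientation = b.orientation := by
  symm
  rw [b.orientation_eq_iff_det_pos]
  have : ⇑(b.reindex σ) = ⇑b ∘ ⇑σ.symm := by ext; simp
  rw [this, AlternatingMap.map_perm, Equiv.Perm.sign_symm, hσ, b.det_self]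
  simp

/-- An orthogonal complex structure anticommuting with a positive one is positive. -/
theorem IsPosOrthComplexStructure.of_isQuatPair [FiniteDimensional ℝ V]
    (hV : Module.finrank ℝ V = 8) {o : Orientation ℝ V (Fin 8)} {I J : V →L[ℝ] V}
    (hI : IsPosOrthComplexStructure o I) (h : IsQuatPair I J) :
    IsPosOrthComplexStructure o J := by
  have : Nontrivial V := Module.nontrivial_of_finrank_pos (R := ℝ) (by omega)
  obtain ⟨v, hv⟩ := exists_norm_eq V (zero_le_one (α := ℝ))
  obtain ⟨b, u, hb⟩ := h.exists_orthonormalBasis hV hv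
  have hbo : b.toBasis.orientation = o :=
    hI.positive b.toBasis (by simp [hb]) (by simp [hb]) (by simp [hb]) (by simp [hb])
  -- The quaternionic basis is complex for I. Two 3-cycles, an even permutation, reorder each half
  -- to (v, Jv, IJv, Iv), which is complex for J because J(IJv) = Iv.
  let τ : Equiv.Perm (Fin 8) := c[1, 3, 2] * c[5, 7, 6]
  refine IsPosOrthComplexStructure.of_basis (b := b.toBasis.reindex τ) h.skew_right h.sq_right
    ?_ (by rw [Module.Basis.orientation_reindex_perm _ _ (by decide), hbo])
  have sJ : ∀ v, J (J v) = -v := fun v => by rw [← mul_apply_eq_comp, h.sq_right]; simp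
  have sK : ∀ v, J (I v) = -I (J v) := fun v => by
    rw [← mul_apply_eq_comp, h.symm.anticomm]; simp
  have t : ⇑τ.symm = ![0, 2, 3, 1, 4, 6, 7, 5] := by decide
  refine ⟨?_, ?_, ?_, ?_⟩ <;> simp [t, hb, sJ, sK]

theorem IsHKTriple.of_isQuatPair [FiniteDimensional ℝ V]
    (hV : Module.finrank ℝ V = 8) {o : Orientation ℝ V (Fin 8)} {I J : V →L[ℝ] V}
    (hI : IsPosOrthComplexStructure o I) (h : IsQuatPair I J) :
    IsHKTriple o ![I, J, I * J] := by
  refine ⟨fun i => ?_, fun v => ?_, fun v => rfl⟩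
  · fin_cases i
    exacts [hI, hI.of_isQuatPair hV h, hI.of_isQuatPair hV h.pair_mul]
  · change (I * J) v = -(J * I) v
    rw [h.anticomm]; rfl

end Orientation

/-! ### Self-duality of the fundamental 4-form -/

section SelfDual

variable {V : Type*} [NormedAddCommGroup V] [InnerProductSpace ℝ V]

theorem Matrix.det_fin_four {R : Type*} [CommRing R] (A : Matrix (Fin 4) (Fin 4) R) :
    A.det =
      A 0 0 * A 1 1 * A 2 2 * A 3 3 - A 0 0 * A 1 1 * A 3 2 * A 2 3
      - A 0 0 * A 2 1 * A 1 2 * A 3 3 + A 0 0 * A 2 1 * A 3 2 * A 1 3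
      + A 0 0 * A 3 1 * A 1 2 * A 2 3 - A 0 0 * A 3 1 * A 2 2 * A 1 3
      - A 1 0 * A 0 1 * A 2 2 * A 3 3 + A 1 0 * A 0 1 * A 3 2 * A 2 3
      + A 1 0 * A 2 1 * A 0 2 * A 3 3 - A 1 0 * A 2 1 * A 3 2 * A 0 3
      - A 1 0 * A 3 1 * A 0 2 * A 2 3 + A 1 0 * A 3 1 * A 2 2 * A 0 3
      + A 2 0 * A 0 1 * A 1 2 * A 3 3 - A 2 0 * A 0 1 * A 3 2 * A 1 3
      - A 2 0 * A 1 1 * A 0 2 * A 3 3 + A 2 0 * A 1 1 * A 3 2 * A 0 3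
      + A 2 0 * A 3 1 * A 0 2 * A 1 3 - A 2 0 * A 3 1 * A 1 2 * A 0 3
      - A 3 0 * A 0 1 * A 1 2 * A 2 3 + A 3 0 * A 0 1 * A 2 2 * A 1 3
      + A 3 0 * A 1 1 * A 0 2 * A 2 3 - A 3 0 * A 1 1 * A 2 2 * A 0 3
      - A 3 0 * A 2 1 * A 0 2 * A 1 3 + A 3 0 * A 2 1 * A 1 2 * A 0 3 := by
  rw [Matrix.det_apply']
  simp only [Fin.prod_univ_four]
  exact sum_perm_fin_four (fun a b c d => A a 0 * A b 1 * A c 2 * A d 3)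

/-- A determinant whose last four vectors belong to the basis. -/
theorem OrthonormalBasis.det_last_four (e : OrthonormalBasis (Fin 8) ℝ V) (u : Fin 4 → V) :
    e.toBasis.det ![u 0, u 1, u 2, u 3, e 4, e 5, e 6, e 7] =
      Matrix.det (Matrix.of fun i j : Fin 4 => (inner ℝ (e (Fin.castAdd 4 i)) (u j) : ℝ)) := by
  rw [Module.Basis.det_apply, ← Matrix.det_reindex_self (finSumFinEquiv (m := 4) (n := 4)).symm]
  -- In the basis e the last four columns are unit vectors, so the matrix is block triangular with
  -- an identity block.
  trans (Matrix.fromBlocks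
      (Matrix.of fun i j : Fin 4 => (inner ℝ (e (Fin.castAdd 4 i)) (u j) : ℝ)) 0
      (Matrix.of fun i j : Fin 4 => (inner ℝ (e (Fin.natAdd 4 i)) (u j) : ℝ)) 1).det
  swap
  · rw [Matrix.det_fromBlocks_zero₁₂, Matrix.det_one, mul_one]
  congr 1
  have h : ∀ i v, e.toBasis.repr v i = inner ℝ (e i) v := fun i v => by
    simp [e.repr_apply_apply]
  have ho := orthonormal_iff_ite.1 e.orthonormal
  have hl : ∀ j : Fin 4, ![u 0, u 1, u 2, u 3, e 4, e 5, e 6, e 7] (Fin.castAdd 4 j) = u j := by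
    intro j; fin_cases j <;> rfl
  have hr : ∀ j : Fin 4, ![u 0, u 1, u 2, u 3, e 4, e 5, e 6, e 7] (Fin.natAdd 4 j) =
      e (Fin.natAdd 4 j) := by
    intro j; fin_cases j <;> rfl
  ext i j
  simp only [Matrix.reindex_apply, Matrix.submatrix_apply, Module.Basis.toMatrix_apply, h]
  rcases i with i | i <;> rcases j with j | j
  · exact congrArg (inner ℝ (e (Fin.castAdd 4 i))) (hl j)
  · refine (congrArg (inner ℝ (e (Fin.castAdd 4 i))) (hr j)).trans ((ho _ _).trans (if_neg ?_))
    intro hij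
    have := congrArg Fin.val hij
    simp at this
    omega
  · exact congrArg (inner ℝ (e (Fin.natAdd 4 i))) (hl j)
  · refine (congrArg (inner ℝ (e (Fin.natAdd 4 i))) (hr j)).trans ((ho _ _).trans ?_)
    rw [Matrix.fromBlocks_apply₂₂, Matrix.one_apply]
    refine if_congr ⟨fun hij => ?_, fun hij => by rw [hij]⟩ rfl rfl
    have := congrArg Fin.val hij
    simp at this
    exact Fin.ext this

/-- The contraction of a bilinear form in an orthonormal basis does not depend on the basis. -/
theorem OrthonormalBasis.sum_apply_apply_eq {ι κ : Type*} [Fintype ι] [Fintype κ]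
    (b : OrthonormalBasis ι ℝ V) (e : OrthonormalBasis κ ℝ V) (ψ : V →ₗ[ℝ] V →ₗ[ℝ] ℝ) :
    ∑ k, ψ (b k) (b k) = ∑ k, ψ (e k) (e k) := by
  classical
  have h : ∀ k, ψ (b k) (b k) = ∑ m, ∑ n, inner ℝ (e m) (b k) * inner ℝ (b k) (e n) *
      ψ (e m) (e n) := by
    intro k
    conv_lhs => rw [← e.sum_repr' (b k)]
    simp only [map_sum, LinearMap.sum_apply, map_smul, LinearMap.smul_apply, smul_eq_mul,
      Finset.mul_sum]
    rw [Finset.sum_comm]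
    refine Finset.sum_congr rfl fun m _ => Finset.sum_congr rfl fun n _ => ?_
    rw [real_inner_comm (e n)]; ring
  simp only [h]
  rw [Finset.sum_comm]
  refine Finset.sum_congr rfl fun m _ => ?_
  rw [Finset.sum_comm]
  simp only [← Finset.sum_mul, b.sum_inner_mul_inner, orthonormal_iff_ite.1 e.orthonormal]
  simp

/-- The contraction of an alternating 8-form with the bivector of `J` in an orthonormal family,
twice. -/
def doubleContraction (D : V [⋀^Fin 8]→ₗ[ℝ] ℝ) (J : V →L[ℝ] V) (b : Fin 8 → V) (x : Fin 4 → V) :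
    ℝ :=
  ∑ k, ∑ l, D ![b k, J (b k), b l, J (b l), x 0, x 1, x 2, x 3]

/-- With one index fixed the summand is a bilinear form on the diagonal, whose contraction is basis
independent; the two indices are replaced one after the other. -/
theorem doubleContraction_eq (D : V [⋀^Fin 8]→ₗ[ℝ] ℝ) (J : V →L[ℝ] V)
    (b e : OrthonormalBasis (Fin 8) ℝ V) (x : Fin 4 → V) :
    doubleContraction D J b x = doubleContraction D J e x := by
  let ψ : V → V →ₗ[ℝ] V →ₗ[ℝ] ℝ := fun z => LinearMap.mk₂ ℝ
    (fun y y' => D.curryLeft z |>.curryLeft (J z) |>.curryLeft y |>.curryLeft (J y') x)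
    (by intros; simp) (by intros; simp) (by intros; simp) (by intros; simp)
  let χ : V → V →ₗ[ℝ] V →ₗ[ℝ] ℝ := fun z => LinearMap.mk₂ ℝ
    (fun y y' => D.curryLeft y |>.curryLeft (J y') |>.curryLeft z |>.curryLeft (J z) x)
    (by intros; simp) (by intros; simp) (by intros; simp) (by intros; simp)
  have hx : x = ![x 0, x 1, x 2, x 3] := by ext1 i; fin_cases i <;> rfl
  have h : ∀ z y, D ![z, J z, y, J y, x 0, x 1, x 2, x 3] = ψ z y y := by
    intro z y
    conv_rhs => simp only [ψ, LinearMap.mk₂_apply, AlternatingMap.curryLeft_apply_apply]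
    rw [hx]; rfl
  have h' : ∀ z y, D ![y, J y, z, J z, x 0, x 1, x 2, x 3] = χ z y y := by
    intro z y
    conv_rhs => simp only [χ, LinearMap.mk₂_apply, AlternatingMap.curryLeft_apply_apply]
    rw [hx]; rfl
  unfold doubleContraction
  trans ∑ k, ∑ l, D ![b k, J (b k), e l, J (e l), x 0, x 1, x 2, x 3]
  · refine Finset.sum_congr rfl fun k _ => ?_
    simp only [h]
    exact b.sum_apply_apply_eq e _
  · rw [Finset.sum_comm, Finset.sum_comm (f := fun k l => D ![e k, _, _, _, _, _, _, _])]
    refine Finset.sum_congr rfl fun k _ => ?_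
    simp only [h']
    exact b.sum_apply_apply_eq e _

/-- An index among the last four repeats a vector and kills its term. The remaining terms are 4 × 4
determinants in the first four coordinates, and their sum is the wedge square. -/
theorem doubleContraction_last_four (e : OrthonormalBasis (Fin 8) ℝ V) {J : V →L[ℝ] V}
    (hJ : IsSkewEnd J) :
    doubleContraction e.toBasis.det J e ![e 4, e 5, e 6, e 7] =
      4 * wedgeTwo (kahlerForm J) (kahlerForm J) ![e 0, e 1, e 2, e 3] := by
  have z1 : ∀ (k : Fin 4) (l : Fin 8), e.toBasis.det ![e (Fin.natAdd 4 k), J (e (Fin.natAdd 4 k)),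
      e l, J (e l), e 4, e 5, e 6, e 7] = 0 := fun k l =>
    AlternatingMap.map_eq_zero_of_eq (i := 0) (j := Fin.natAdd 4 k) _ _
      (by fin_cases k <;> rfl) (by fin_cases k <;> decide)
  have z2 : ∀ (k : Fin 8) (l : Fin 4), e.toBasis.det ![e k, J (e k),
      e (Fin.natAdd 4 l), J (e (Fin.natAdd 4 l)), e 4, e 5, e 6, e 7] = 0 := fun k l =>
    AlternatingMap.map_eq_zero_of_eq (i := 2) (j := Fin.natAdd 4 l) _ _
      (by fin_cases l <;> rfl) (by fin_cases l <;> decide)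
  have h : doubleContraction e.toBasis.det J e ![e 4, e 5, e 6, e 7] =
      ∑ k : Fin 4, ∑ l : Fin 4, Matrix.det (Matrix.of fun i j : Fin 4 =>
        (inner ℝ (e (Fin.castAdd 4 i)) (![e (Fin.castAdd 4 k), J (e (Fin.castAdd 4 k)),
          e (Fin.castAdd 4 l), J (e (Fin.castAdd 4 l))] j) : ℝ)) := by
    unfold doubleContraction
    trans ∑ k : Fin 4, ∑ l : Fin 4, e.toBasis.det ![e (Fin.castAdd 4 k), J (e (Fin.castAdd 4 k)),
      e (Fin.castAdd 4 l), J (e (Fin.castAdd 4 l)), e 4, e 5, e 6, e 7]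
    · refine (Fin.sum_univ_add (a := 4) (b := 4) _).trans ?_
      refine (congrArg₂ (· + ·) (Finset.sum_congr rfl fun k _ => ?_)
        (Finset.sum_eq_zero fun k _ => ?_)).trans (add_zero _)
      · refine (Fin.sum_univ_add (a := 4) (b := 4) _).trans ?_
        exact (congrArg₂ (· + ·) rfl (Finset.sum_eq_zero fun l _ => z2 _ l)).trans (add_zero _)
      · exact Finset.sum_eq_zero fun l _ => z1 k l
    · refine Finset.sum_congr rfl fun k _ => Finset.sum_congr rfl fun l _ => ?_
      exact e.det_last_four ![e (Fin.castAdd 4 k), J (e (Fin.castAdd 4 k)),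
          e (Fin.castAdd 4 l), J (e (Fin.castAdd 4 l))]
  have ho := orthonormal_iff_ite.1 e.orthonormal
  have key : ∀ u w, inner ℝ u (J w) = - inner ℝ w (J u) := fun u w => by
    rw [← hJ, real_inner_comm]
  have key0 : ∀ u, inner ℝ u (J u) = (0 : ℝ) := fun u => by linarith [key u u]
  rw [h, wedgeTwo_kahlerForm_apply hJ]
  simp only [Matrix.det_fin_four, Matrix.of_apply, Matrix.cons_val, ho]
  simp only [Fin.sum_univ_four, hJ _ _, key0]
  have c0 : Fin.castAdd 4 (0 : Fin 4) = (0 : Fin 8) := rfl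
  have c1 : Fin.castAdd 4 (1 : Fin 4) = (1 : Fin 8) := rfl
  have c2 : Fin.castAdd 4 (2 : Fin 4) = (2 : Fin 8) := rfl
  have c3 : Fin.castAdd 4 (3 : Fin 4) = (3 : Fin 8) := rfl
  simp [c0, c1, c2, c3]
  rw [key (e 1) (e 0), key (e 2) (e 0), key (e 3) (e 0), key (e 2) (e 1), key (e 3) (e 1),
    key (e 3) (e 2)]
  ring

theorem OrthonormalBasis.det_first_four_perm (e : OrthonormalBasis (Fin 8) ℝ V)
    (σ : Equiv.Perm (Fin 8)) (hσ : Equiv.Perm.sign σ = 1) (x : Fin 4 → V) :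
    e.toBasis.det ![e (σ 4), e (σ 5), e (σ 6), e (σ 7), x 0, x 1, x 2, x 3] =
      Matrix.det (Matrix.of fun i j : Fin 4 => (inner ℝ (e (σ (Fin.castAdd 4 i))) (x j) : ℝ)) := by
  have h1 := (e.reindex σ.symm).det_last_four x
  have h2 : (e.reindex σ.symm).toBasis.det = e.toBasis.det := by
    refine OrthonormalBasis.same_orientation_iff_det_eq_det.2 ?_
    rw [OrthonormalBasis.reindex_toBasis]
    exact Module.Basis.orientation_reindex_perm _ _ (by rw [Equiv.Perm.sign_symm, hσ])
  rw [h2] at h1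
  simp only [OrthonormalBasis.reindex_apply, Equiv.symm_symm] at h1
  rw [← h1]
  -- Exchanging the first and last four arguments takes four transpositions, so no sign appears.
  let τ : Equiv.Perm (Fin 8) := c[0, 4] * c[1, 5] * c[2, 6] * c[3, 7]
  have h3 := e.toBasis.det.map_perm
    ![x 0, x 1, x 2, x 3, e (σ 4), e (σ 5), e (σ 6), e (σ 7)] τ
  rw [show Equiv.Perm.sign τ = 1 by decide, one_smul] at h3
  rw [← h3]
  congr 1
  have t : ⇑τ = ![4, 5, 6, 7, 0, 1, 2, 3] := by decide
  ext1 i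
  rw [Function.comp_apply, t]
  fin_cases i <;> rfl

/-- The basis splits V into four J-planes, and both basis vectors of a plane give the same bivector.
Each unordered pair of planes thus occurs eight times, and its term is the 4 × 4 minor in the
complementary planes. Since ω is the sum of the four plane forms, ω ∧ ω is twice the sum of these
minors. -/
theorem doubleContraction_complexBasis (e : OrthonormalBasis (Fin 8) ℝ V) {J : V →L[ℝ] V}
    (hJ : IsSkewEnd J) (sq : ∀ v, J (J v) = -v) (he : IsComplexBasis J e.toBasis) (x : Fin 4 → V) :
    doubleContraction e.toBasis.det J e x =
      4 * wedgeTwo (kahlerForm J) (kahlerForm J) x := by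
  obtain ⟨h1, h3, h5, h7⟩ := he
  simp only [OrthonormalBasis.coe_toBasis] at h1 h3 h5 h7
  have j0 : J (e 0) = e 1 := h1.symm
  have j2 : J (e 2) = e 3 := h3.symm
  have j4 : J (e 4) = e 5 := h5.symm
  have j6 : J (e 6) = e 7 := h7.symm
  have j1 : J (e 1) = -e 0 := by rw [h1, sq]
  have j3 : J (e 3) = -e 2 := by rw [h3, sq]
  have j5 : J (e 5) = -e 4 := by rw [h5, sq]
  have j7 : J (e 7) = -e 6 := by rw [h7, sq]
  set D := e.toBasis.det
  let F : V → V → V → V → ℝ := fun a b c d => D ![a, b, c, d, x 0, x 1, x 2, x 3]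
  have hF : ∀ a b c d, D ![a, b, c, d, x 0, x 1, x 2, x 3] = F a b c d := fun a b c d => rfl
  have f0 : ∀ a b c d, F b a c d = -F a b c d := by
    intro a b c d
    have := D.map_swap ![a, b, c, d, x 0, x 1, x 2, x 3] (i := 0) (j := 1) (by decide)
    refine Eq.trans (congrArg D ?_) this
    ext1 i; fin_cases i <;> rfl
  have f1 : ∀ a b c d, F b (-a) c d = F a b c d := by
    intro a b c d
    have := D.map_update_neg ![b, a, c, d, x 0, x 1, x 2, x 3] 1 a
    rw [show F a b c d = -F b a c d from f0 b a c d]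
    refine Eq.trans (congrArg D ?_) (this.trans (congrArg (fun t => -D t) ?_)) <;>
      · ext1 i; fin_cases i <;> rfl
  have f3 : ∀ a b c d, F c d a b = F a b c d := by
    intro a b c d
    have := D.map_perm ![a, b, c, d, x 0, x 1, x 2, x 3] (c[0, 2] * c[1, 3])
    rw [show Equiv.Perm.sign (c[0, 2] * c[1, 3] : Equiv.Perm (Fin 8)) = 1 by decide,
      one_smul] at this
    refine Eq.trans (congrArg D ?_) this
    have t : ⇑(c[0, 2] * c[1, 3] : Equiv.Perm (Fin 8)) = ![2, 3, 0, 1, 4, 5, 6, 7] := by decide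
    ext1 i
    rw [Function.comp_apply, t]
    fin_cases i <;> rfl
  have f2 : ∀ a b c d, F a b d (-c) = F a b c d := by
    intro a b c d
    rw [← f3, f1, f3]
  have f4 : ∀ a b, F a b a b = 0 := fun a b =>
    D.map_eq_zero_of_eq (i := 0) (j := 2) _ rfl (by decide)
  -- With plane i spanned by e (2i) and e (2i+1), the digits name the two planes inserted into D;
  -- the value is the minor in the other two.
  have g23 := e.det_first_four_perm 1 (by simp) x
  have g13 := e.det_first_four_perm (c[2, 4] * c[3, 5]) (by decide) x
  have g03 := e.det_first_four_perm (c[0, 4] * c[1, 5]) (by decide) x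
  have g12 := e.det_first_four_perm (c[2, 6] * c[3, 7]) (by decide) x
  have g02 := e.det_first_four_perm (c[0, 6] * c[1, 7]) (by decide) x
  have g01 := e.det_first_four_perm (c[0, 4] * c[1, 5] * c[2, 6] * c[3, 7]) (by decide) x
  have s13 : ⇑(c[2, 4] * c[3, 5] : Equiv.Perm (Fin 8)) = ![0, 1, 4, 5, 2, 3, 6, 7] := by decide
  have s03 : ⇑(c[0, 4] * c[1, 5] : Equiv.Perm (Fin 8)) = ![4, 5, 2, 3, 0, 1, 6, 7] := by decide
  have s12 : ⇑(c[2, 6] * c[3, 7] : Equiv.Perm (Fin 8)) = ![0, 1, 6, 7, 4, 5, 2, 3] := by decide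
  have s02 : ⇑(c[0, 6] * c[1, 7] : Equiv.Perm (Fin 8)) = ![6, 7, 2, 3, 4, 5, 0, 1] := by decide
  have s01 : ⇑(c[0, 4] * c[1, 5] * c[2, 6] * c[3, 7] : Equiv.Perm (Fin 8)) =
    ![4, 5, 6, 7, 0, 1, 2, 3] := by decide
  rw [s13] at g13
  rw [s03] at g03
  rw [s12] at g12
  rw [s02] at g02
  rw [s01] at g01
  have c0 : Fin.castAdd 4 (0 : Fin 4) = (0 : Fin 8) := rfl
  have c1 : Fin.castAdd 4 (1 : Fin 4) = (1 : Fin 8) := rfl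
  have c2 : Fin.castAdd 4 (2 : Fin 4) = (2 : Fin 8) := rfl
  have c3 : Fin.castAdd 4 (3 : Fin 4) = (3 : Fin 8) := rfl
  simp only [Matrix.det_fin_four, Matrix.of_apply, c0, c1, c2, c3, Equiv.Perm.coe_one, id,
    Matrix.cons_val] at g01 g02 g03 g12 g13 g23
  have hsum : doubleContraction D J e x =
      8 * (F (e 4) (e 5) (e 6) (e 7) + F (e 2) (e 3) (e 6) (e 7) + F (e 0) (e 1) (e 6) (e 7)
        + F (e 4) (e 5) (e 2) (e 3) + F (e 4) (e 5) (e 0) (e 1) + F (e 0) (e 1) (e 2) (e 3)) := by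
    unfold doubleContraction
    simp only [Fin.sum_univ_eight, j0, j1, j2, j3, j4, j5, j6, j7, hF, f1, f2, f4]
    rw [f3 (e 4) (e 5) (e 6) (e 7), f3 (e 2) (e 3) (e 6) (e 7), f3 (e 0) (e 1) (e 6) (e 7),
      f3 (e 4) (e 5) (e 2) (e 3), f3 (e 4) (e 5) (e 0) (e 1), f3 (e 0) (e 1) (e 2) (e 3)]
    ring
  have hω : ∀ a b, inner ℝ (J a) b = inner ℝ (e 0) a * inner ℝ (e 1) b
      - inner ℝ (e 1) a * inner ℝ (e 0) b + inner ℝ (e 2) a * inner ℝ (e 3) b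
      - inner ℝ (e 3) a * inner ℝ (e 2) b + inner ℝ (e 4) a * inner ℝ (e 5) b
      - inner ℝ (e 5) a * inner ℝ (e 4) b + inner ℝ (e 6) a * inner ℝ (e 7) b
      - inner ℝ (e 7) a * inner ℝ (e 6) b := by
    intro a b
    rw [← e.sum_inner_mul_inner (J a) b]
    simp only [Fin.sum_univ_eight, hJ a, j0, j1, j2, j3, j4, j5, j6, j7, inner_neg_right,
      real_inner_comm a]
    ring
  rw [hsum, wedgeTwo_kahlerForm_apply hJ]
  rw [show F (e 4) (e 5) (e 6) (e 7) = _ from g23, show F (e 2) (e 3) (e 6) (e 7) = _ from g13,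
    show F (e 0) (e 1) (e 6) (e 7) = _ from g03, show F (e 4) (e 5) (e 2) (e 3) = _ from g12,
    show F (e 4) (e 5) (e 0) (e 1) = _ from g02, show F (e 0) (e 1) (e 2) (e 3) = _ from g01]
  simp only [hω]
  ring

/-- The double contraction of the volume form is evaluated at e₄, …, e₇ twice. In e it gives the
wedge square at e₀, …, e₃; in the adapted basis b it gives the wedge square at e₄, …, e₇. Both bases
are positive, so they have the same volume form. -/
theorem IsPosOrthComplexStructure.wedgeTwo_selfDual {o : Orientation ℝ V (Fin 8)} {J : V →L[ℝ] V}
    (h : IsPosOrthComplexStructure o J) (b : OrthonormalBasis (Fin 8) ℝ V)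
    (hb : IsComplexBasis J b.toBasis) :
    IsSelfDual o (wedgeTwo (kahlerForm J) (kahlerForm J)) := by
  intro e he
  have hbo : b.toBasis.orientation = o := h.positive _ hb.1 hb.2.1 hb.2.2.1 hb.2.2.2
  have hdet : e.toBasis.det = b.toBasis.det :=
    OrthonormalBasis.same_orientation_iff_det_eq_det.2 (he.trans hbo.symm)
  have h1 := doubleContraction_last_four e h.skew
  rw [hdet, doubleContraction_eq _ J e b,
    doubleContraction_complexBasis b h.skew h.sq hb] at h1
  linarith

theorem IsSelfDual.add {o : Orientation ℝ V (Fin 8)} {α β : V [⋀^Fin 4]→ₗ[ℝ] ℝ}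
    (hα : IsSelfDual o α) (hβ : IsSelfDual o β) : IsSelfDual o (α + β) := fun e he => by
  simp only [AlternatingMap.add_apply, hα e he, hβ e he]

theorem IsSelfDual.smul {o : Orientation ℝ V (Fin 8)} {α : V [⋀^Fin 4]→ₗ[ℝ] ℝ}
    (hα : IsSelfDual o α) (c : ℝ) : IsSelfDual o (c • α) := fun e he => by
  simp only [AlternatingMap.smul_apply, hα e he]

theorem IsHKTriple.isSelfDual_hkForm [FiniteDimensional ℝ V] (hV : Module.finrank ℝ V = 8)
    {o : Orientation ℝ V (Fin 8)} {J : Fin 3 → V →L[ℝ] V} (h : IsHKTriple o J) :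
    IsSelfDual o (hkForm J) := by
  have : Nontrivial V := Module.nontrivial_of_finrank_pos (R := ℝ) (by omega)
  obtain ⟨v, hv⟩ := exists_norm_eq V (zero_le_one (α := ℝ))
  have key : ∀ {I K : V →L[ℝ] V}, IsPosOrthComplexStructure o I → IsQuatPair I K →
      IsSelfDual o (wedgeTwo (kahlerForm I) (kahlerForm I)) := by
    intro I K hI hIK
    obtain ⟨b, u, hb⟩ := hIK.exists_orthonormalBasis hV hv
    exact hI.wedgeTwo_selfDual b ⟨by simp [hb], by simp [hb], by simp [hb], by simp [hb]⟩
  have q := h.isQuatPair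
  refine IsSelfDual.smul ?_ _
  rw [Fin.sum_univ_three]
  refine ((key (h.complex 0) q).add (key (h.complex 1) q.symm)).add (key (h.complex 2) (K := J 0) ?_)
  rw [h.eq_mul]
  exact q.pair_mul.symm

end SelfDual

/-! ### Quaternionic Hermitian endomorphisms and anticommutators -/

section QuaternionicHermitian

variable {V : Type*} [NormedAddCommGroup V] [InnerProductSpace ℝ V]

/-- The Cayley-Hamilton theorem for quaternionic Hermitian endomorphisms of `ℍ²`. -/
theorem IsQuatPair.exists_mul_self_eq [FiniteDimensional ℝ V] (hV : Module.finrank ℝ V = 8)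
    {I J W : V →L[ℝ] V} (h : IsQuatPair I J) (hW : ∀ u v, inner ℝ (W u) v = (inner ℝ u (W v) : ℝ))
    (hI : I * W = W * I) (hJ : J * W = W * J) :
    ∃ d : ℝ, W * W = (endTrace W / 4) • W - d • 1 := by
  have hsym : W.toLinearMap.IsSymmetric := hW
  set v := hsym.eigenvectorBasis hV 0
  set w₁ := hsym.eigenvalues hV 0
  have hv : W v = w₁ • v := hsym.apply_eigenvectorBasis hV 0
  obtain ⟨b, u, hb⟩ := h.exists_orthonormalBasis hV (v := v)
    ((hsym.eigenvectorBasis hV).orthonormal.1 0)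
  have ho := orthonormal_iff_ite.1 b.orthonormal
  have cI : ∀ x, W (I x) = I (W x) := fun x => by
    rw [← mul_apply_eq_comp, ← hI]; rfl
  have cJ : ∀ x, W (J x) = J (W x) := fun x => by
    rw [← mul_apply_eq_comp, ← hJ]; rfl
  -- For symmetric W commuting with skew α, the product αW is skew.
  have z : ∀ {α : V →L[ℝ] V}, IsSkewEnd α → (∀ x, W (α x) = α (W x)) →
      ∀ x, inner ℝ (α x) (W x) = (0 : ℝ) := by
    intro α hα hc x
    have h1 : inner ℝ (α x) (W x) = -(inner ℝ (α x) (W x) : ℝ) := by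
      conv_lhs => rw [hα, ← hc, ← hW, real_inner_comm]
    linarith
  -- W preserves the orbit of v, so W u has no component there; the components along I u, J u and I
  -- (J u) vanish by `z`.
  have hu : W u = (inner ℝ u (W u) : ℝ) • u := by
    conv_lhs => rw [← b.sum_repr' (W u)]
    have e : ∀ i : Fin 8, i < 4 → inner ℝ (b i) (W u) = (0 : ℝ) := by
      intro i hi
      have h4 : W (b i) = w₁ • b i := by
        fin_cases i <;> simp at hi <;> simp [hb, cI, cJ, hv]
      have h5 : u = b 4 := by simp [hb]
      rw [← hW, h4, inner_smul_left, h5, ho, if_neg (ne_of_lt hi), mul_zero]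
    rw [Fin.sum_univ_eight, e 0 (by decide), e 1 (by decide), e 2 (by decide), e 3 (by decide)]
    have e5 : inner ℝ (b 5) (W u) = (0 : ℝ) := by simpa [hb] using z h.skew_left cI u
    have e6 : inner ℝ (b 6) (W u) = (0 : ℝ) := by simpa [hb] using z h.skew_right cJ u
    have e7 : inner ℝ (b 7) (W u) = (0 : ℝ) := by
      simpa [hb] using z h.skew_mul (fun x => by simp [cI, cJ]) u
    rw [e5, e6, e7]
    simp [hb]
  set w₂ : ℝ := inner ℝ u (W u)
  have hWb : ∀ i, W (b i) = (![w₁, w₁, w₁, w₁, w₂, w₂, w₂, w₂] i) • b i := by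
    intro i
    fin_cases i <;> simp [hb, cI, cJ, hv, hu]
  have htr : endTrace W = 4 * w₁ + 4 * w₂ := by
    rw [endTrace_eq_sum b]
    simp only [hWb, inner_smul_right, ho]
    simp [Fin.sum_univ_eight]
    ring
  -- Both eigenvalues occur four times, so tr W / 4 = w₁ + w₂ and the relation is (W - w₁)(W - w₂) =
  -- 0.
  refine ⟨w₁ * w₂, ?_⟩
  have : (W * W).toLinearMap = ((endTrace W / 4) • W - (w₁ * w₂) • 1 : V →L[ℝ] V).toLinearMap := by
    refine b.toBasis.ext fun i => ?_
    simp only [OrthonormalBasis.coe_toBasis, ContinuousLinearMap.coe_coe, mul_apply_eq_comp,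
      sub_apply, smul_apply, one_apply_eq_self, hWb, map_smul, htr, smul_smul,
      ← sub_smul]
    congr 1
    fin_cases i <;> simp <;> ring
  exact ContinuousLinearMap.coe_injective this

theorem endInner_eq_of_anticommutator [FiniteDimensional ℝ V] (hV : Module.finrank ℝ V = 8)
    {α β : V →L[ℝ] V} {c : ℝ} (h : α * β + β * α = c • 1) : endInner α β = -c / 2 := by
  have h1 := congrArg endTrace h
  rw [map_add, endTrace_mul_comm β α, map_smul, endTrace_one, hV, smul_eq_mul] at h1
  rw [endInner_apply]
  push_cast at h1
  linarith

/-- Let S and T be the anticommutators of J with J' and with IJ'. Both are symmetric and commute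
with I and J, so each satisfies a quadratic equation, and S² + T² = 4. As tr T = 0, T² is a scalar,
hence so is S². As tr S ≠ 0, the quadratic equation for S expresses S itself as a scalar. -/
theorem IsQuatPair.anticommutator_eq [FiniteDimensional ℝ V] (hV : Module.finrank ℝ V = 8)
    {I J J' : V →L[ℝ] V} (h : IsQuatPair I J) (h' : IsQuatPair I J')
    (h0 : endInner J (I * J') = 0) (h1 : endInner J J' ≠ 0) :
    J * J' + J' * J = (-2 * endInner J J') • 1 := by
  have sym : ∀ {α β : V →L[ℝ] V}, IsSkewEnd α → IsSkewEnd β →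
      ∀ u v, inner ℝ ((α * β + β * α) u) v = (inner ℝ u ((α * β + β * α) v) : ℝ) := by
    intro α β hα hβ u v
    simp only [add_apply, mul_apply_eq_comp, inner_add_left, inner_add_right, hα _ _, hβ _ _]
    ring
  have commJ : ∀ β : V →L[ℝ] V, J * (J * β + β * J) = (J * β + β * J) * J := by
    intro β
    rw [mul_add, add_mul, ← mul_assoc, h.sq_right, mul_assoc β, h.sq_right, mul_assoc, add_comm]
    simp
  have commI : ∀ {β : V →L[ℝ] V}, I * β = -(β * I) → I * (J * β + β * J) = (J * β + β * J) * I := by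
    intro β hβ
    rw [mul_add, add_mul, ← mul_assoc, h.anticomm, neg_mul, mul_assoc, hβ, ← mul_assoc, hβ, neg_mul,
      mul_assoc, h.anticomm]
    simp [mul_assoc]
  set A := J * J' with hA
  set B := J' * J with hB
  set S := A + B with hS
  have eT : J * (I * J') + I * J' * J = -(I * (A - B)) := by
    rw [mul_sub, hA, hB, ← mul_assoc, h.symm.anticomm, ← mul_assoc, ← mul_assoc]
    simp only [neg_mul]
    abel
  have IA : I * A = A * I := by
    rw [hA, ← mul_assoc, h.anticomm, neg_mul, mul_assoc, h'.anticomm, mul_neg, neg_neg, mul_assoc]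
  have IB : I * B = B * I := by
    rw [hB, ← mul_assoc, h'.anticomm, neg_mul, mul_assoc, h.anticomm, mul_neg, neg_neg, mul_assoc]
  have AB : A * B = 1 := by
    rw [hA, hB, mul_assoc, ← mul_assoc J', h'.sq_right, neg_one_mul, mul_neg, h.sq_right, neg_neg]
  have BA : B * A = 1 := by
    rw [hA, hB, mul_assoc, ← mul_assoc J, h.sq_right, neg_one_mul, mul_neg, h'.sq_right, neg_neg]
  set T := J * (I * J') + I * J' * J with hT
  have TT : T * T = -((A - B) * (A - B)) := by
    rw [eT, neg_mul_neg, mul_assoc, ← mul_assoc (A - B), sub_mul A B I, ← IA, ← IB, ← mul_sub,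
      mul_assoc I (A - B), ← mul_assoc I I, h.sq_left, neg_one_mul]
  -- A and B are mutually inverse and commute with I, so T² = -(A - B)² and the sum is 2AB + 2BA.
  have ST : S * S + T * T = (4 : ℝ) • 1 := by
    rw [TT, hS]
    have : (A + B) * (A + B) + -((A - B) * (A - B)) = (2 : ℝ) • (A * B) + (2 : ℝ) • (B * A) := by
      rw [two_smul, two_smul]; noncomm_ring
    rw [this, AB, BA, ← add_smul]; norm_num
  obtain ⟨d, hd⟩ := h.exists_mul_self_eq hV (sym h.skew_right h'.skew_mul)
    (commI h'.pair_mul.anticomm) (commJ _)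
  obtain ⟨d', hd'⟩ := h.exists_mul_self_eq hV (sym h.skew_right h'.skew_right)
    (commI h'.anticomm) (commJ _)
  have trT : endTrace T = 0 := by
    rw [hT, map_add, endTrace_mul_comm (I * J') J, endTrace_mul_eq, h0]; simp
  have trS : endTrace S = -16 * endInner J J' := by
    rw [hS, map_add, hB, endTrace_mul_comm J' J, hA, endTrace_mul_eq]; ring
  rw [trT, zero_div, zero_smul, zero_sub] at hd
  rw [trS] at hd'
  have hne : -16 * endInner J J' / 4 ≠ 0 := by
    refine div_ne_zero (mul_ne_zero (by norm_num) h1) (by norm_num)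
  have hSs : S = ((-16 * endInner J J' / 4)⁻¹ * (4 + d + d')) • 1 := by
    have : (-16 * endInner J J' / 4) • S = (4 + d + d') • 1 := by
      have e : S * S = (4 + d) • (1 : V →L[ℝ] V) := by
        rw [add_smul, ← ST, hd]; abel
      rw [e] at hd'
      rw [add_smul, hd']; abel
    rw [mul_smul, ← this, smul_smul, inv_mul_cancel₀ hne, one_smul]
  have := endInner_eq_of_anticommutator hV hSs
  rw [hSs]
  congr 1
  linarith

end QuaternionicHermitian

/-! ### The span of a hyper-Kähler triple as imaginary quaternions -/

section HKSpan

variable {V : Type*} [NormedAddCommGroup V] [InnerProductSpace ℝ V]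

/-- The multiple of `α` of norm one (or zero). -/
def endNormalize (α : V →L[ℝ] V) : V →L[ℝ] V := (√(endInner α α))⁻¹ • α

theorem endInner_endNormalize_left (α β : V →L[ℝ] V) :
    endInner (endNormalize α) β = (√(endInner α α))⁻¹ * endInner α β := by
  rw [endNormalize, map_smul]; rfl

theorem endInner_endNormalize_right (α β : V →L[ℝ] V) :
    endInner β (endNormalize α) = (√(endInner α α))⁻¹ * endInner β α := by
  rw [endNormalize, map_smul]; rfl

theorem endInner_endNormalize_self {α : V →L[ℝ] V} (h : 0 < endInner α α) :
    endInner (endNormalize α) (endNormalize α) = 1 := by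
  rw [endInner_endNormalize_left, endInner_endNormalize_right, ← mul_assoc, ← mul_inv,
    Real.mul_self_sqrt h.le, inv_mul_cancel₀ h.ne']

/-- `E` is spanned by a hyper-Kähler triple. -/
def IsHKSpan (o : Orientation ℝ V (Fin 8)) (E : Submodule ℝ (V →L[ℝ] V)) : Prop :=
  ∃ J : Fin 3 → V →L[ℝ] V, IsHKTriple o J ∧ E = Submodule.span ℝ (Set.range J)

variable {o : Orientation ℝ V (Fin 8)}

theorem IsHKSpan.skew {E : Submodule ℝ (V →L[ℝ] V)} (hE : IsHKSpan o E) {α : V →L[ℝ] V}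
    (hα : α ∈ E) : IsSkewEnd α := by
  obtain ⟨J, h, rfl⟩ := hE
  induction hα using Submodule.span_induction with
  | mem x hx => obtain ⟨i, rfl⟩ := hx; exact (h.complex i).skew
  | zero => intro u v; simp
  | add x y _ _ hx hy => exact hx.add hy
  | smul c x _ hx => exact hx.smul c

variable [FiniteDimensional ℝ V]

theorem IsHKTriple.endInner_eq (hV : Module.finrank ℝ V = 8) {J : Fin 3 → V →L[ℝ] V}
    (h : IsHKTriple o J) (i k : Fin 3) :
    endInner (J i) (J k) = if i = k then 1 else 0 := by
  have q := h.isQuatPair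
  have one : ∀ {α : V →L[ℝ] V}, α * α = -1 → endInner α α = 1 := by
    intro α hα
    rw [endInner_apply, hα, map_neg, endTrace_one, hV]; norm_num
  have z := @endInner_eq_zero_of_anticomm V _ _
  rw [h.eq_cons]
  fin_cases i <;> fin_cases k
  · simpa using one q.sq_left
  · simpa using z q.anticomm
  · simpa using z q.pair_mul.anticomm
  · simpa using z q.symm.anticomm
  · simpa using one q.sq_right
  · simpa using z q.rotate.anticomm
  · simpa using z q.pair_mul.symm.anticomm
  · simpa using z q.rotate.symm.anticomm
  · simpa using one q.rotate.sq_right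

theorem IsHKTriple.linearIndependent (hV : Module.finrank ℝ V = 8) {J : Fin 3 → V →L[ℝ] V}
    (h : IsHKTriple o J) : LinearIndependent ℝ J := by
  rw [Fintype.linearIndependent_iff]
  intro g hg k
  have := congrArg (fun α => endInner α (J k)) hg
  simpa [h.endInner_eq hV, LinearMap.sum_apply] using this

namespace IsHKSpan

variable {E : Submodule ℝ (V →L[ℝ] V)}

theorem finrank_eq (hV : Module.finrank ℝ V = 8) (hE : IsHKSpan o E) :
    Module.finrank ℝ E = 3 := by
  obtain ⟨J, h, rfl⟩ := hE
  rw [finrank_span_eq_card (h.linearIndependent hV), Fintype.card_fin]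

/-- The real part of a product of imaginary quaternions is minus their inner product. By bilinearity
this is checked on the nine products of the triple. -/
theorem mul_add_mem (hV : Module.finrank ℝ V = 8) (hE : IsHKSpan o E) {α β : V →L[ℝ] V}
    (hα : α ∈ E) (hβ : β ∈ E) : α * β + endInner α β • 1 ∈ E := by
  obtain ⟨J, h, rfl⟩ := hE
  have q := h.isQuatPair
  have mem : ∀ i, J i ∈ Submodule.span ℝ (Set.range J) := fun i => Submodule.subset_span ⟨i, rfl⟩
  induction hα using Submodule.span_induction with
  | zero => simp
  | add x y _ _ hx hy =>
    have := Submodule.add_mem _ hx hy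
    rw [add_mul, map_add, LinearMap.add_apply, add_smul]
    convert this using 1; abel
  | smul c x _ hx =>
    have := Submodule.smul_mem _ c hx
    rw [smul_mul_assoc, map_smul, LinearMap.smul_apply, smul_eq_mul, mul_smul, ← smul_add]
    exact this
  | mem x hx =>
    obtain ⟨i, rfl⟩ := hx
    induction hβ using Submodule.span_induction with
    | zero => simp
    | add x y _ _ hx hy =>
      have := Submodule.add_mem _ hx hy
      rw [mul_add, map_add, add_smul]
      convert this using 1; abel
    | smul c x _ hx =>
      have := Submodule.smul_mem _ c hx
      rw [mul_smul_comm, map_smul, smul_eq_mul, mul_smul, ← smul_add]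
      exact this
    | mem x hx =>
      obtain ⟨k, rfl⟩ := hx
      have m0 := mem 0
      have m1 := mem 1
      have m2 := mem 2
      have sq : ∀ i, J i * J i = -1 := fun i => (h.complex i).mul_self
      rw [h.endInner_eq hV]
      rw [h.eq_mul] at m2
      have e2 := h.eq_mul
      fin_cases i <;> fin_cases k <;> simp [sq, e2] <;> try assumption
      · rw [q.mul_mul_left]; exact Submodule.neg_mem _ m1
      · rw [q.symm.anticomm]; exact Submodule.neg_mem _ m2
      · rw [← mul_assoc, q.symm.anticomm, neg_mul, q.mul_mul_right, neg_neg]; exact m0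
      · rw [q.pair_mul.symm.anticomm, q.mul_mul_left, neg_neg]; exact m1
      · rw [q.mul_mul_right]; exact Submodule.neg_mem _ m0
      · rw [q.rotate.sq_right]; simp

/-- The adjoint of αβ is βα, while αβ + ⟨α, β⟩ lies in E and is therefore skew. -/
theorem anticommutator_eq (hV : Module.finrank ℝ V = 8) (hE : IsHKSpan o E) {α β : V →L[ℝ] V}
    (hα : α ∈ E) (hβ : β ∈ E) : α * β + β * α = (-2 * endInner α β) • 1 := by
  have h1 := hE.skew (hE.mul_add_mem hV hα hβ)
  have h2 : ∀ u v, inner ℝ ((α * β) u) v = (inner ℝ u ((β * α) v) : ℝ) := fun u v => by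
    rw [mul_apply_eq_comp, mul_apply_eq_comp, hE.skew hα, hE.skew hβ, neg_neg]
  ext1 v
  refine ext_inner_left ℝ fun u => ?_
  have h3 := h1 u v
  simp only [add_apply, inner_add_left, inner_add_right, smul_apply, one_apply_eq_self,
    inner_smul_left, inner_smul_right, h2, conj_trivial] at h3 ⊢
  linarith

theorem isQuatPair (hV : Module.finrank ℝ V = 8) (hE : IsHKSpan o E) {α β : V →L[ℝ] V}
    (hα : α ∈ E) (hβ : β ∈ E) (h1 : endInner α α = 1) (h2 : endInner β β = 1)
    (h3 : endInner α β = 0) : IsQuatPair α β := by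
  have sq : ∀ {γ : V →L[ℝ] V}, γ ∈ E → endInner γ γ = 1 → γ * γ = -1 := by
    intro γ hγ h
    have := hE.anticommutator_eq hV hγ hγ
    rw [h, ← two_smul ℝ] at this
    have h' := congrArg (fun x => (1 / 2 : ℝ) • x) this
    simpa [smul_smul] using h'
  refine ⟨hE.skew hα, hE.skew hβ, sq hα h1, sq hβ h2, ?_⟩
  have := hE.anticommutator_eq hV hα hβ
  rw [h3, mul_zero, zero_smul] at this
  exact eq_neg_of_add_eq_zero_left this

/-- Two linear conditions on a 3-dimensional space leave a nonzero solution. -/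
theorem exists_unit (hV : Module.finrank ℝ V = 8) (hE : IsHKSpan o E) (β γ : V →L[ℝ] V) :
    ∃ α ∈ E, endInner α α = 1 ∧ endInner α β = 0 ∧ endInner α γ = 0 := by
  let f : E →ₗ[ℝ] ℝ × ℝ := ((endInner β).prod (endInner γ)).comp E.subtype
  have hf : LinearMap.ker f ≠ ⊥ := LinearMap.ker_ne_bot_of_finrank_lt (by
    rw [hE.finrank_eq hV]; simp)
  obtain ⟨α, hα, hα0⟩ := Submodule.exists_mem_ne_zero_of_ne_bot hf
  have hα' : endInner β (α : V →L[ℝ] V) = 0 ∧ endInner γ (α : V →L[ℝ] V) = 0 := by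
    simpa [f] using hα
  have hpos : 0 < endInner (α : V →L[ℝ] V) α := by
    refine lt_of_le_of_ne (hE.skew α.2).endInner_self_nonneg fun h => hα0 ?_
    exact Subtype.ext ((hE.skew α.2).eq_zero_of_endInner_self h.symm)
  refine ⟨endNormalize α, E.smul_mem _ α.2, endInner_endNormalize_self hpos, ?_, ?_⟩
  · rw [endInner_endNormalize_left, endInner_comm _ β, hα'.1, mul_zero]
  · rw [endInner_endNormalize_left, endInner_comm _ γ, hα'.2, mul_zero]

/-- Positivity passes between anticommuting structures: from J 0 to a unit β orthogonal to both J 0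
and α, then from β to α. -/
theorem isPos (hV : Module.finrank ℝ V = 8) (hE : IsHKSpan o E) {α : V →L[ℝ] V}
    (hα : α ∈ E) (h1 : endInner α α = 1) : IsPosOrthComplexStructure o α := by
  have hE' := hE
  obtain ⟨J, h, hJ⟩ := hE'
  have hJ0 : J 0 ∈ E := hJ ▸ Submodule.subset_span ⟨0, rfl⟩
  obtain ⟨β, hβ, hβ1, hβα, hβJ⟩ := hE.exists_unit hV α (J 0)
  have hpos : IsPosOrthComplexStructure o β := (h.complex 0).of_isQuatPair hV
    (hE.isQuatPair hV hJ0 hβ (by simp [h.endInner_eq hV]) hβ1 (by rw [endInner_comm, hβJ]))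
  exact hpos.of_isQuatPair hV (hE.isQuatPair hV hβ hα hβ1 h1 hβα)

theorem mul_mem (hV : Module.finrank ℝ V = 8) (hE : IsHKSpan o E) {α β : V →L[ℝ] V}
    (hα : α ∈ E) (hβ : β ∈ E) (h : endInner α β = 0) : α * β ∈ E := by
  simpa [h] using hE.mul_add_mem hV hα hβ

theorem isHKTriple (hV : Module.finrank ℝ V = 8) (hE : IsHKSpan o E) {α β : V →L[ℝ] V}
    (hα : α ∈ E) (hβ : β ∈ E) (h1 : endInner α α = 1) (h2 : endInner β β = 1)
    (h3 : endInner α β = 0) : IsHKTriple o ![α, β, α * β] :=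
  IsHKTriple.of_isQuatPair hV (hE.isPos hV hα h1) (hE.isQuatPair hV hα hβ h1 h2 h3)

theorem eq_span (hV : Module.finrank ℝ V = 8) (hE : IsHKSpan o E) {α β : V →L[ℝ] V}
    (hα : α ∈ E) (hβ : β ∈ E) (h1 : endInner α α = 1) (h2 : endInner β β = 1)
    (h3 : endInner α β = 0) : E = Submodule.span ℝ (Set.range ![α, β, α * β]) := by
  have ht := hE.isHKTriple hV hα hβ h1 h2 h3
  symm
  refine Submodule.eq_of_le_of_finrank_eq ?_ ?_
  · rw [Submodule.span_le]
    rintro _ ⟨i, rfl⟩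
    fin_cases i
    exacts [hα, hβ, hE.mul_mem hV hα hβ h3]
  · rw [hE.finrank_eq hV, finrank_span_eq_card (ht.linearIndependent hV), Fintype.card_fin]

end IsHKSpan

end HKSpan

/-! ### Two hyper-Kähler spans with a common complex structure -/

section HKPair

variable {V : Type*} [NormedAddCommGroup V] [InnerProductSpace ℝ V]

/-- The orthogonal projection onto the span of the orthonormal triple `J`. -/
def hkProj (J : Fin 3 → V →L[ℝ] V) (α : V →L[ℝ] V) : V →L[ℝ] V := ∑ j, endInner α (J j) • J j

theorem hkProj_mem (J : Fin 3 → V →L[ℝ] V) (α : V →L[ℝ] V) :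
    hkProj J α ∈ Submodule.span ℝ (Set.range J) :=
  Submodule.sum_mem _ fun j _ => Submodule.smul_mem _ _ (Submodule.subset_span ⟨j, rfl⟩)

theorem hkProj_add (J : Fin 3 → V →L[ℝ] V) (α β : V →L[ℝ] V) :
    hkProj J (α + β) = hkProj J α + hkProj J β := by
  simp [hkProj, add_smul, Finset.sum_add_distrib]

theorem hkProj_smul (J : Fin 3 → V →L[ℝ] V) (c : ℝ) (α : V →L[ℝ] V) :
    hkProj J (c • α) = c • hkProj J α := by
  simp [hkProj, mul_smul, Finset.smul_sum]

variable [FiniteDimensional ℝ V] {o : Orientation ℝ V (Fin 8)}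

theorem IsHKTriple.endInner_hkProj (hV : Module.finrank ℝ V = 8) {J : Fin 3 → V →L[ℝ] V}
    (h : IsHKTriple o J) (α : V →L[ℝ] V) {β : V →L[ℝ] V}
    (hβ : β ∈ Submodule.span ℝ (Set.range J)) : endInner (hkProj J α) β = endInner α β := by
  induction hβ using Submodule.span_induction with
  | mem x hx =>
    obtain ⟨i, rfl⟩ := hx
    simp [hkProj, LinearMap.sum_apply, h.endInner_eq hV]
  | zero => simp
  | add x y _ _ hx hy => simp [hx, hy]
  | smul c x _ hx => simp [hx]

theorem IsHKTriple.hkProj_eq (hV : Module.finrank ℝ V = 8) {J : Fin 3 → V →L[ℝ] V}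
    (h : IsHKTriple o J) {α β : V →L[ℝ] V} (hβ : β ∈ Submodule.span ℝ (Set.range J))
    (hαβ : ∀ γ ∈ Submodule.span ℝ (Set.range J), endInner β γ = endInner α γ) :
    hkProj J α = β := by
  have hE : IsHKSpan o (Submodule.span ℝ (Set.range J)) := ⟨J, h, rfl⟩
  have hm := Submodule.sub_mem _ (hkProj_mem J α) hβ
  refine sub_eq_zero.1 ((hE.skew hm).eq_zero_of_endInner_self ?_)
  have : endInner (hkProj J α - β) (hkProj J α - β) =
      endInner (hkProj J α) (hkProj J α - β) - endInner β (hkProj J α - β) := by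
    rw [map_sub endInner]; rfl
  rw [this, h.endInner_hkProj hV _ hm, hαβ _ hm, sub_self]

/-- The squared cosine between the complements of a common complex structure in the spans of two
hyper-Kähler triples. -/
def hkCosSq (J J' : Fin 3 → V →L[ℝ] V) : ℝ := (9 * formInner (hkForm J) (hkForm J') - 14) / 16

variable {J J' : Fin 3 → V →L[ℝ] V}

theorem exists_common_unit (h : IsHKTriple o J)
    (hd : 1 ≤ Module.finrank ℝ ↥(Submodule.span ℝ (Set.range J) ⊓ Submodule.span ℝ (Set.range J'))) :
    ∃ I ∈ Submodule.span ℝ (Set.range J), I ∈ Submodule.span ℝ (Set.range J') ∧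
      endInner I I = 1 := by
  have hE : IsHKSpan o (Submodule.span ℝ (Set.range J)) := ⟨J, h, rfl⟩
  obtain ⟨⟨α, hα, hα'⟩, hα0⟩ := Module.finrank_pos_iff_exists_ne_zero.1 (by omega :
    0 < Module.finrank ℝ ↥(Submodule.span ℝ (Set.range J) ⊓ Submodule.span ℝ (Set.range J')))
  have hpos : 0 < endInner α α := by
    refine lt_of_le_of_ne (hE.skew hα).endInner_self_nonneg fun h => hα0 ?_
    exact Subtype.ext ((hE.skew hα).eq_zero_of_endInner_self h.symm)
  exact ⟨endNormalize α, Submodule.smul_mem _ _ hα, Submodule.smul_mem _ _ hα',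
    endInner_endNormalize_self hpos⟩

/-- `I` is a common unit element of the spans of the hyper-Kähler triples `J` and `J'`, and `K` is a
unit element of the first span orthogonal to `I`. -/
structure IsCommonFrame (o : Orientation ℝ V (Fin 8)) (J J' : Fin 3 → V →L[ℝ] V)
    (I K : V →L[ℝ] V) : Prop where
  left : IsHKTriple o J
  right : IsHKTriple o J'
  mem_left : I ∈ Submodule.span ℝ (Set.range J)
  mem_right : I ∈ Submodule.span ℝ (Set.range J')
  mem : K ∈ Submodule.span ℝ (Set.range J)
  norm_common : endInner I I = 1
  norm : endInner K K = 1
  orth : endInner I K = 0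

theorem exists_isCommonFrame (hV : Module.finrank ℝ V = 8) (h : IsHKTriple o J)
    (h' : IsHKTriple o J') (hd : 1 ≤ Module.finrank ℝ
      ↥(Submodule.span ℝ (Set.range J) ⊓ Submodule.span ℝ (Set.range J'))) :
    ∃ I K, IsCommonFrame o J J' I K := by
  obtain ⟨I, hI, hI', hI1⟩ := exists_common_unit h hd
  obtain ⟨K, hK, hK1, hIK, -⟩ := IsHKSpan.exists_unit hV ⟨J, h, rfl⟩ I I
  exact ⟨I, K, h, h', hI, hI', hK, hI1, hK1, by rw [endInner_comm, hIK]⟩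

namespace IsCommonFrame

variable {I K : V →L[ℝ] V}

theorem isHKSpan_left (c : IsCommonFrame o J J' I K) :
    IsHKSpan o (Submodule.span ℝ (Set.range J)) := ⟨J, c.left, rfl⟩

theorem isHKSpan_right (c : IsCommonFrame o J J' I K) :
    IsHKSpan o (Submodule.span ℝ (Set.range J')) := ⟨J', c.right, rfl⟩

theorem isQuatPair (c : IsCommonFrame o J J' I K) (hV : Module.finrank ℝ V = 8) :
    IsQuatPair I K :=
  c.isHKSpan_left.isQuatPair hV c.mem_left c.mem c.norm_common c.norm c.orth

theorem endInner_hkProj (c : IsCommonFrame o J J' I K) (hV : Module.finrank ℝ V = 8) :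
    endInner I (hkProj J' K) = 0 := by
  rw [endInner_comm, c.right.endInner_hkProj hV _ c.mem_right, endInner_comm, c.orth]

theorem hkForm_left (c : IsCommonFrame o J J' I K) (hV : Module.finrank ℝ V = 8) :
    hkForm ![I, K, I * K] = hkForm J :=
  hkForm_eq_of_span_eq c.left
    (c.isHKSpan_left.isHKTriple hV c.mem_left c.mem c.norm_common c.norm c.orth)
    (c.isHKSpan_left.eq_span hV c.mem_left c.mem c.norm_common c.norm c.orth).symm

/-- In an orthonormal basis (I, L, IL) of the second span the projection of K has coordinates 0, ⟨K,
L⟩, ⟨K, IL⟩; the sum of their squares is read off from the formula for the inner product of the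
4-forms. -/
theorem endInner_hkProj_self (c : IsCommonFrame o J J' I K) (hV : Module.finrank ℝ V = 8) :
    endInner (hkProj J' K) (hkProj J' K) = hkCosSq J J' := by
  obtain ⟨L, hL, hL1, hIL, -⟩ := c.isHKSpan_right.exists_unit hV I I
  rw [endInner_comm] at hIL
  have hs := c.isHKSpan_right.eq_span hV c.mem_right hL c.norm_common hL1 hIL
  have ht := c.isHKSpan_right.isHKTriple hV c.mem_right hL c.norm_common hL1 hIL
  have hq := c.isHKSpan_right.isQuatPair hV c.mem_right hL c.norm_common hL1 hIL
  have hIL' := c.isHKSpan_right.mul_mem hV c.mem_right hL hIL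
  have hproj : hkProj J' K = endInner K L • L + endInner K (I * L) • (I * L) := by
    refine c.right.hkProj_eq hV (Submodule.add_mem _ (Submodule.smul_mem _ _ hL)
      (Submodule.smul_mem _ _ hIL')) fun γ hγ => ?_
    rw [hs] at hγ
    have e := ht.endInner_eq hV
    induction hγ using Submodule.span_induction with
    | mem x hx =>
      obtain ⟨i, rfl⟩ := hx
      have e1 := e 1 i
      have e2 := e 2 i
      simp only [map_add, map_smul, LinearMap.add_apply, LinearMap.smul_apply, smul_eq_mul]
      rw [show endInner L _ = _ from e1, show endInner (I * L) _ = _ from e2]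
      fin_cases i
      · simp [endInner_comm K I, c.orth]
      · simp
      · simp
    | zero => simp
    | add x y _ _ hx hy => rw [map_add, hx, hy, map_add]
    | smul r x _ hx => rw [map_smul, hx, map_smul]
  have hF := formInner_hkForm_of_common hV (c.isQuatPair hV) hq
  rw [c.hkForm_left hV, hkForm_eq_of_span_eq c.right ht hs.symm] at hF
  rw [hkCosSq, hF, c.right.endInner_hkProj hV _ (hkProj_mem _ _), hproj, map_add, map_smul,
    map_smul, smul_eq_mul, smul_eq_mul]
  ring

theorem hkCosSq_nonneg (c : IsCommonFrame o J J' I K) (hV : Module.finrank ℝ V = 8) :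
    0 ≤ hkCosSq J J' := by
  rw [← c.endInner_hkProj_self hV]
  exact (c.isHKSpan_right.skew (hkProj_mem _ _)).endInner_self_nonneg

theorem endInner_hkProj_eq (c : IsCommonFrame o J J' I K) (hV : Module.finrank ℝ V = 8) :
    endInner K (hkProj J' K) = hkCosSq J J' := by
  rw [← c.endInner_hkProj_self hV, c.right.endInner_hkProj hV _ (hkProj_mem _ _)]

/-- Let R be the projection of K. As IR lies in the second span, ⟨K, IR⟩ = ⟨R, IR⟩, and R
anticommutes with IR. This makes the normalized R the right endpoint for a path starting at K. -/
theorem endInner_mul_hkProj (c : IsCommonFrame o J J' I K) (hV : Module.finrank ℝ V = 8) :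
    endInner K (I * hkProj J' K) = 0 := by
  have hR := hkProj_mem J' K
  have hz := c.endInner_hkProj hV
  have ha := c.isHKSpan_right.anticommutator_eq hV c.mem_right hR
  rw [hz, mul_zero, zero_smul] at ha
  rw [← c.right.endInner_hkProj hV _ (c.isHKSpan_right.mul_mem hV c.mem_right hR hz)]
  refine endInner_eq_zero_of_anticomm ?_
  rw [← mul_assoc, eq_neg_of_add_eq_zero_right ha, neg_mul]

/-- The projection of K to the second span has inner products 0, `hkCosSq`, 0 with I, K, IK: the
complements of I in the two spans are isoclinic planes. -/
theorem hkProj_hkProj (c : IsCommonFrame o J J' I K) (hV : Module.finrank ℝ V = 8) :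
    hkProj J (hkProj J' K) = hkCosSq J J' • K := by
  refine c.left.hkProj_eq hV (Submodule.smul_mem _ _ c.mem) fun γ hγ => ?_
  have hs := c.isHKSpan_left.eq_span hV c.mem_left c.mem c.norm_common c.norm c.orth
  have ht := c.isHKSpan_left.isHKTriple hV c.mem_left c.mem c.norm_common c.norm c.orth
  rw [hs] at hγ
  induction hγ using Submodule.span_induction with
  | zero => simp
  | add x y _ _ hx hy => rw [map_add, hx, hy, map_add]
  | smul r x _ hx => rw [map_smul, hx, map_smul]
  | mem x hx =>
    obtain ⟨i, rfl⟩ := hx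
    rw [map_smul, LinearMap.smul_apply, smul_eq_mul, show endInner K _ = _ from
      ht.endInner_eq hV 1 i]
    have hR := hkProj_mem J' K
    have hz := c.endInner_hkProj hV
    have ha := c.isHKSpan_right.anticommutator_eq hV c.mem_right hR
    rw [hz, mul_zero, zero_smul] at ha
    have hw := c.endInner_mul_hkProj hV
    fin_cases i
    · simpa [endInner_comm _ I] using hz.symm
    · simpa [endInner_comm _ K] using (c.endInner_hkProj_eq hV).symm
    · have : endInner (hkProj J' K) (I * K) = 0 := by
        rw [endInner_apply, ← mul_assoc, eq_neg_of_add_eq_zero_right ha, neg_mul, map_neg,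
          endTrace_mul_comm, endTrace_mul_eq, hw]
        simp
      simpa using this.symm

/-- The double projection fixes I and scales K and IK by `hkCosSq`. The left side does not mention
I, so it recovers the common line from the triples alone. -/
theorem hkProj_hkProj_sub (c : IsCommonFrame o J J' I K) (hV : Module.finrank ℝ V = 8)
    {α : V →L[ℝ] V} (hα : α ∈ Submodule.span ℝ (Set.range J)) :
    hkProj J (hkProj J' α) - hkCosSq J J' • α =
      ((1 - hkCosSq J J') * endInner α I) • I := by
  have hs := c.isHKSpan_left.eq_span hV c.mem_left c.mem c.norm_common c.norm c.orth
  have ht := c.isHKSpan_left.isHKTriple hV c.mem_left c.mem c.norm_common c.norm c.orth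
  rw [hs] at hα
  induction hα using Submodule.span_induction with
  | zero => simp [hkProj]
  | add x y _ _ hx hy =>
    rw [hkProj_add, hkProj_add, smul_add, add_sub_add_comm, hx, hy, map_add, LinearMap.add_apply,
      mul_add, add_smul]
  | smul r x _ hx =>
    rw [hkProj_smul, hkProj_smul, smul_comm, ← smul_sub, hx, map_smul, LinearMap.smul_apply,
      smul_smul, smul_eq_mul]
    congr 1
    ring
  | mem x hx =>
    obtain ⟨i, rfl⟩ := hx
    rw [show endInner _ I = _ from ht.endInner_eq hV i 0]
    fin_cases i
    · have e1 : hkProj J' I = I := c.right.hkProj_eq hV c.mem_right fun _ _ => rfl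
      have e2 : hkProj J I = I := c.left.hkProj_eq hV c.mem_left fun _ _ => rfl
      simp [e1, e2, sub_smul]
    · simp [c.hkProj_hkProj hV]
    · have hIK := c.isHKSpan_left.mul_mem hV c.mem_left c.mem c.orth
      have n : endInner (I * K) (I * K) = 1 := ht.endInner_eq hV 2 2
      have n' : endInner I (I * K) = 0 := ht.endInner_eq hV 0 2
      have c' : IsCommonFrame o J J' I (I * K) :=
        ⟨c.left, c.right, c.mem_left, c.mem_right, hIK, c.norm_common, n, n'⟩
      simp [c'.hkProj_hkProj hV]

/-- At the value 1 the difference of K and its projection has norm 1 - 2 + 1 = 0, so K would be a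
second common element, orthonormal to I. -/
theorem hkCosSq_ne_one (c : IsCommonFrame o J J' I K) (hV : Module.finrank ℝ V = 8)
    (hd : Module.finrank ℝ
      ↥(Submodule.span ℝ (Set.range J) ⊓ Submodule.span ℝ (Set.range J')) = 1) :
    hkCosSq J J' ≠ 1 := by
  intro hc
  have h1 := c.endInner_hkProj_self hV
  have h2 := c.endInner_hkProj_eq hV
  have hR := hkProj_mem J' K
  have hKR : K - hkProj J' K = 0 := by
    refine ((c.isHKSpan_left.skew c.mem).sub (c.isHKSpan_right.skew hR)).eq_zero_of_endInner_self ?_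
    simp only [map_sub, LinearMap.sub_apply, h1, h2, endInner_comm _ K, c.norm, hc]
    norm_num
  have hK' : K ∈ Submodule.span ℝ (Set.range J') := by rw [sub_eq_zero.1 hKR]; exact hR
  obtain ⟨v, -, hv⟩ := finrank_eq_one_iff'.1 hd
  obtain ⟨a, ha⟩ := hv ⟨I, c.mem_left, c.mem_right⟩
  obtain ⟨b, hb⟩ := hv ⟨K, c.mem, hK'⟩
  have ha' : a • (v : V →L[ℝ] V) = I := congrArg Subtype.val ha
  have hb' : b • (v : V →L[ℝ] V) = K := congrArg Subtype.val hb
  have n1 := c.norm_common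
  have n2 := c.norm
  have n3 := c.orth
  rw [← ha'] at n1 n3
  rw [← hb'] at n2 n3
  simp only [map_smul, LinearMap.smul_apply, smul_eq_mul] at n1 n2 n3
  have : (a * (a * endInner (v : V →L[ℝ] V) v)) * (b * (b * endInner (v : V →L[ℝ] V) v)) =
    (b * (a * endInner (v : V →L[ℝ] V) v)) ^ 2 := by ring
  rw [n1, n2] at this
  have n3' : b * (a * endInner (v : V →L[ℝ] V) v) = 0 := by linarith
  rw [n3'] at this
  norm_num at this

theorem mem_endNormalize_hkProj (J' : Fin 3 → V →L[ℝ] V) (K : V →L[ℝ] V) :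
    endNormalize (hkProj J' K) ∈ Submodule.span ℝ (Set.range J') :=
  Submodule.smul_mem _ _ (hkProj_mem _ _)

theorem hkForm_right (c : IsCommonFrame o J J' I K) (hV : Module.finrank ℝ V = 8)
    (hpos : 0 < hkCosSq J J') :
    hkForm ![I, endNormalize (hkProj J' K), I * endNormalize (hkProj J' K)] = hkForm J' := by
  have h1 : endInner (endNormalize (hkProj J' K)) (endNormalize (hkProj J' K)) = 1 :=
    endInner_endNormalize_self (by rwa [c.endInner_hkProj_self hV])
  have h2 : endInner I (endNormalize (hkProj J' K)) = 0 := by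
    rw [endInner_endNormalize_right, c.endInner_hkProj hV, mul_zero]
  exact hkForm_eq_of_span_eq c.right
    (c.isHKSpan_right.isHKTriple hV c.mem_right (mem_endNormalize_hkProj _ _) c.norm_common h1 h2)
    (c.isHKSpan_right.eq_span hV c.mem_right (mem_endNormalize_hkProj _ _) c.norm_common h1 h2).symm

/-- The endpoints K and L square to -1 and their anticommutator is a scalar, so γ² is minus its
squared norm. Being a combination of K and L, γ is skew and anticommutes with I. The norm cannot
vanish because ⟨K, L⟩ > 0. -/
theorem path (c : IsCommonFrame o J J' I K) (hV : Module.finrank ℝ V = 8)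
    (hpos : 0 < hkCosSq J J') {t : ℝ} (ht : t ∈ Set.Icc (0 : ℝ) 1) {γ : V →L[ℝ] V}
    (hγ : γ = (1 - t) • K + t • endNormalize (hkProj J' K)) :
    0 < endInner γ γ ∧ IsHKTriple o ![I, endNormalize γ, I * endNormalize γ] := by
  set L := endNormalize (hkProj J' K) with hL
  have hL1 : endInner L L = 1 :=
    endInner_endNormalize_self (by rwa [c.endInner_hkProj_self hV])
  have hIL : endInner I L = 0 := by
    rw [hL, endInner_endNormalize_right, c.endInner_hkProj hV, mul_zero]
  have hq' : IsQuatPair I L := c.isHKSpan_right.isQuatPair hV c.mem_right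
    (mem_endNormalize_hkProj _ _) c.norm_common hL1 hIL
  have hq := c.isQuatPair hV
  have hKL : 0 < endInner K L := by
    rw [hL, endInner_endNormalize_right, c.endInner_hkProj_eq hV]
    refine mul_pos (inv_pos.2 (Real.sqrt_pos.2 ?_)) hpos
    rwa [c.endInner_hkProj_self hV]
  have hKIL : endInner K (I * L) = 0 := by
    rw [hL, endNormalize, mul_smul_comm, map_smul, c.endInner_mul_hkProj hV, smul_zero]
  have hanti := hq.anticommutator_eq hV hq' hKIL hKL.ne'
  have hn : endInner γ γ = (1 - t) ^ 2 + 2 * (t * (1 - t)) * endInner K L + t ^ 2 := by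
    rw [hγ]
    simp only [map_add, map_smul, LinearMap.add_apply, LinearMap.smul_apply, smul_eq_mul, hL1,
      c.norm, endInner_comm L K]
    ring
  have hnpos : 0 < endInner γ γ := by
    rw [hn]
    have h1 : 0 ≤ t * (1 - t) := mul_nonneg ht.1 (by linarith [ht.2])
    have h2 := mul_nonneg (mul_nonneg zero_le_two h1) hKL.le
    nlinarith [sq_nonneg (t - 1 / 2)]
  refine ⟨hnpos, IsHKTriple.of_isQuatPair hV (c.isHKSpan_left.isPos hV c.mem_left c.norm_common) ?_⟩
  have hγγ : γ * γ = -(endInner γ γ • 1) := by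
    have e : γ * γ = (1 - t) ^ 2 • (K * K) + (t * (1 - t)) • (K * L + L * K) + t ^ 2 • (L * L) := by
      rw [hγ]
      simp only [add_mul, mul_add, smul_mul_assoc, mul_smul_comm]
      module
    rw [e, hanti, hq.sq_right, hq'.sq_right, hn]
    module
  have hsk : IsSkewEnd γ := by
    rw [hγ]; exact (hq.skew_right.smul _).add (hq'.skew_right.smul _)
  refine ⟨hq.skew_left, hsk.smul _, hq.sq_left, ?_, ?_⟩
  · rw [endNormalize, smul_mul_smul_comm, hγγ, smul_neg, smul_smul, ← mul_inv,
      Real.mul_self_sqrt hnpos.le, inv_mul_cancel₀ hnpos.ne', one_smul]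
  · rw [endNormalize, mul_smul_comm, smul_mul_assoc, hγ, mul_add, add_mul, mul_smul_comm,
      mul_smul_comm, smul_mul_assoc, smul_mul_assoc, hq.anticomm, hq'.anticomm]
    module

end IsCommonFrame

end HKPair

/-! ### Smooth fields of vectors and endomorphisms, orthonormal frames -/

section Smooth

variable {M : Type*} [TopologicalSpace M] [ChartedSpace (EuclideanSpace ℝ (Fin 8)) M]

theorem finrank_tangentSpace_eq (p : M) : Module.finrank ℝ (TangentSpace (𝓡 8) p) = 8 :=
  finrank_euclideanSpace_fin (𝕜 := ℝ) (n := 8)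

variable [IsManifold (𝓡 8) ∞ M]

theorem SmoothVectorFieldOn.mono {U W : Set M} {X : ∀ p : M, TangentSpace (𝓡 8) p}
    (hX : SmoothVectorFieldOn M U X) (h : W ⊆ U) : SmoothVectorFieldOn M W X :=
  ContMDiffOn.mono hX h

theorem SmoothEndFieldOn.apply {U : Set M}
    {α : ∀ p : M, TangentSpace (𝓡 8) p →L[ℝ] TangentSpace (𝓡 8) p}
    {X : ∀ p : M, TangentSpace (𝓡 8) p}
    (hα : SmoothEndFieldOn M U α) (hX : SmoothVectorFieldOn M U X) :
    SmoothVectorFieldOn M U (fun p => α p (X p)) :=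
  ContMDiffOn.clm_bundle_apply (F₁ := EuclideanSpace ℝ (Fin 8)) (F₂ := EuclideanSpace ℝ (Fin 8))
    (E₁ := fun p : M => TangentSpace (𝓡 8) p) (E₂ := fun p : M => TangentSpace (𝓡 8) p) hα hX

theorem SmoothVectorFieldOn.add {U : Set M} {X Y : ∀ p : M, TangentSpace (𝓡 8) p}
    (hX : SmoothVectorFieldOn M U X) (hY : SmoothVectorFieldOn M U Y) :
    SmoothVectorFieldOn M U (fun p => X p + Y p) :=
  ContMDiffOn.add_section (V := fun p : M => TangentSpace (𝓡 8) p) hX hY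

theorem SmoothVectorFieldOn.smul {U : Set M} {f : M → ℝ} {X : ∀ p : M, TangentSpace (𝓡 8) p}
    (hf : ContMDiffOn (𝓡 8) 𝓘(ℝ, ℝ) ∞ f U) (hX : SmoothVectorFieldOn M U X) :
    SmoothVectorFieldOn M U (fun p => f p • X p) :=
  ContMDiffOn.smul_section (V := fun p : M => TangentSpace (𝓡 8) p) hf hX

/-- The field `A` of endomorphisms maps smooth vector fields to smooth vector fields. -/
def MapsSmoothFields (U : Set M)
    (A : ∀ p : M, TangentSpace (𝓡 8) p →L[ℝ] TangentSpace (𝓡 8) p) : Prop :=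
  ∀ W ⊆ U, ∀ X : ∀ p : M, TangentSpace (𝓡 8) p, SmoothVectorFieldOn M W X →
    SmoothVectorFieldOn M W (fun p => A p (X p))

theorem SmoothEndFieldOn.mapsSmoothFields {U : Set M}
    {A : ∀ p : M, TangentSpace (𝓡 8) p →L[ℝ] TangentSpace (𝓡 8) p}
    (hA : SmoothEndFieldOn M U A) : MapsSmoothFields U A :=
  fun _ hW _ hX => SmoothEndFieldOn.apply (ContMDiffOn.mono hA hW) hX

namespace MapsSmoothFields

variable {U : Set M} {A B : ∀ p : M, TangentSpace (𝓡 8) p →L[ℝ] TangentSpace (𝓡 8) p}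

theorem mono {U' : Set M} (hA : MapsSmoothFields U A) (h : U' ⊆ U) : MapsSmoothFields U' A :=
  fun W hW X hX => hA W (hW.trans h) X hX

theorem add (hA : MapsSmoothFields U A) (hB : MapsSmoothFields U B) :
    MapsSmoothFields U (fun p => A p + B p) :=
  fun W hW X hX => (hA W hW X hX).add (hB W hW X hX)

theorem mul (hA : MapsSmoothFields U A) (hB : MapsSmoothFields U B) :
    MapsSmoothFields U (fun p => A p * B p) :=
  fun W hW X hX => hA W hW _ (hB W hW X hX)

theorem smul {f : M → ℝ} (hf : ContMDiffOn (𝓡 8) 𝓘(ℝ, ℝ) ∞ f U) (hA : MapsSmoothFields U A) :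
    MapsSmoothFields U (fun p => f p • A p) :=
  fun W hW X hX => SmoothVectorFieldOn.smul (hf.mono hW) (hA W hW X hX)

theorem sub (hA : MapsSmoothFields U A) (hB : MapsSmoothFields U B) :
    MapsSmoothFields U (fun p => A p - B p) := by
  have := hA.add (hB.smul (f := fun _ => -1) contMDiffOn_const)
  simpa [sub_eq_add_neg] using this

theorem sum_three {f : Fin 3 → M → ℝ}
    {J : Fin 3 → ∀ p : M, TangentSpace (𝓡 8) p →L[ℝ] TangentSpace (𝓡 8) p}
    (hf : ∀ i, ContMDiffOn (𝓡 8) 𝓘(ℝ, ℝ) ∞ (f i) U) (hJ : ∀ i, MapsSmoothFields U (J i)) :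
    MapsSmoothFields U (fun p => ∑ i, f i p • J i p) := by
  simp only [Fin.sum_univ_three]
  exact (((hJ 0).smul (hf 0)).add ((hJ 1).smul (hf 1))).add ((hJ 2).smul (hf 2))

end MapsSmoothFields

theorem contMDiffOn_inv_sqrt {E H N : Type*} [NormedAddCommGroup E] [NormedSpace ℝ E]
    [TopologicalSpace H] [TopologicalSpace N] [ChartedSpace H N] {I : ModelWithCorners ℝ E H}
    {f : N → ℝ} {S : Set N} (hf : ContMDiffOn I 𝓘(ℝ, ℝ) ∞ f S) (hpos : ∀ x ∈ S, 0 < f x) :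
    ContMDiffOn I 𝓘(ℝ, ℝ) ∞ (fun x => (√(f x))⁻¹) S := by
  intro x hx
  have h : ContDiffAt ℝ ∞ (fun y : ℝ => (√y)⁻¹) (f x) :=
    (Real.contDiffAt_sqrt (hpos x hx).ne').inv (Real.sqrt_ne_zero'.2 (hpos x hx))
  exact h.contMDiffAt.comp_contMDiffWithinAt x (hf x hx)

variable [RiemannianBundle (fun p : M => TangentSpace (𝓡 8) p)]
  [IsContMDiffRiemannianBundle (𝓡 8) ∞ (EuclideanSpace ℝ (Fin 8))
    (fun p : M => TangentSpace (𝓡 8) p)]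

theorem SmoothVectorFieldOn.inner {U : Set M} {X Y : ∀ p : M, TangentSpace (𝓡 8) p}
    (hX : SmoothVectorFieldOn M U X) (hY : SmoothVectorFieldOn M U Y) :
    ContMDiffOn (𝓡 8) 𝓘(ℝ, ℝ) ∞ (fun p => (inner ℝ (X p) (Y p) : ℝ)) U :=
  ContMDiffOn.inner_bundle (F := EuclideanSpace ℝ (Fin 8))
    (E := fun p : M => TangentSpace (𝓡 8) p) hX hY

/-- Smooth orthonormal frames exist near every point. -/
theorem ManifoldOrientation.exists_orthonormal_frame (o : ManifoldOrientation M) (p₀ : M) :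
    ∃ U : Set M, IsOpen U ∧ p₀ ∈ U ∧ ∃ e : Fin 8 → ∀ p : M, TangentSpace (𝓡 8) p,
      (∀ i, SmoothVectorFieldOn M U (e i)) ∧
      ∀ p ∈ U, ∃ b : OrthonormalBasis (Fin 8) ℝ (TangentSpace (𝓡 8) p), ∀ i, b i = e i p := by
  obtain ⟨U, hU, hp, X, hX, hb⟩ := o.exists_frame p₀
  have hli : ∀ p ∈ U, LinearIndependent ℝ (fun i => X i p) := by
    intro p hp
    obtain ⟨b, hb, -⟩ := hb p hp
    rw [show (fun i => X i p) = b from funext fun i => (hb i).symm]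
    exact b.linearIndependent
  -- Strong induction along Gram-Schmidt; the denominators are nonzero because the frame is linearly
  -- independent on U.
  have hgs : ∀ (n : ℕ) (hn : n < 8), SmoothVectorFieldOn M U
      (fun p => InnerProductSpace.gramSchmidt ℝ (fun i => X i p) ⟨n, hn⟩) := by
    intro n
    induction n using Nat.strong_induction_on with
    | _ n ih =>
      intro hn
      have hinner : ∀ i : Fin 8, i < ⟨n, hn⟩ → SmoothVectorFieldOn M U
          (fun p => ((inner ℝ (InnerProductSpace.gramSchmidt ℝ (fun i => X i p) i)
            (X ⟨n, hn⟩ p) : ℝ) / (‖InnerProductSpace.gramSchmidt ℝ (fun i => X i p) i‖ : ℝ) ^ 2) •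
            InnerProductSpace.gramSchmidt ℝ (fun i => X i p) i) := by
        intro i hi
        have h1 := ih i hi i.2
        refine SmoothVectorFieldOn.smul ?_ h1
        refine ((h1.inner (hX ⟨n, hn⟩)).mul ((h1.inner h1).inv₀ fun p hp => ?_)).congr fun p _ => ?_
        · exact inner_self_ne_zero.2 (InnerProductSpace.gramSchmidt_ne_zero _ (hli p hp))
        · rw [div_eq_mul_inv, ← real_inner_self_eq_norm_sq]
          rfl
      have hsum : SmoothVectorFieldOn M U (fun p => ∑ i ∈ Finset.Iio (⟨n, hn⟩ : Fin 8),
          ((inner ℝ (InnerProductSpace.gramSchmidt ℝ (fun i => X i p) i)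
            (X ⟨n, hn⟩ p) : ℝ) / (‖InnerProductSpace.gramSchmidt ℝ (fun i => X i p) i‖ : ℝ) ^ 2) •
            InnerProductSpace.gramSchmidt ℝ (fun i => X i p) i) :=
        ContMDiffOn.sum_section fun i hi => hinner i (Finset.mem_Iio.1 hi)
      have h2 : SmoothVectorFieldOn M U _ := ContMDiffOn.sub_section (hX ⟨n, hn⟩) hsum
      convert h2 using 2 with p
      exact eq_sub_of_add_eq (InnerProductSpace.gramSchmidt_def'' ℝ (fun i => X i p) _).symm
  refine ⟨U, hU, hp, fun i p => InnerProductSpace.gramSchmidtNormed ℝ (fun i => X i p) i, ?_, ?_⟩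
  · intro i
    have h1 := hgs i i.2
    have h2 := contMDiffOn_inv_sqrt (h1.inner h1) fun p hp =>
      real_inner_self_pos.2 (InnerProductSpace.gramSchmidt_ne_zero _ (hli p hp))
    have h3 := SmoothVectorFieldOn.smul h2 h1
    convert h3 using 2 with p
    rw [← norm_eq_sqrt_real_inner]
    rfl
  · intro p hp
    have h1 := InnerProductSpace.gramSchmidtNormed_orthonormal (hli p hp)
    refine ⟨InnerProductSpace.gramSchmidtOrthonormalBasis
      (by simp [finrank_tangentSpace_eq]) fun i => X i p, fun i => ?_⟩
    exact InnerProductSpace.gramSchmidtOrthonormalBasis_apply _ (h1.ne_zero i)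

end Smooth

/-! ### Smooth one-parameter families of endomorphisms and 4-forms -/

section Families

variable {M : Type*} [TopologicalSpace M] [ChartedSpace (EuclideanSpace ℝ (Fin 8)) M]
  [IsManifold (𝓡 8) ∞ M]

theorem SmoothFormFamilyOn.add {U : Set M} {Ω Θ : ℝ → FourFormField M}
    (hΩ : SmoothFormFamilyOn M U Ω) (hΘ : SmoothFormFamilyOn M U Θ) :
    SmoothFormFamilyOn M U (fun t p => Ω t p + Θ t p) :=
  fun W hW hWU X hX => (hΩ W hW hWU X hX).add (hΘ W hW hWU X hX)

theorem SmoothFormFamilyOn.smul {U : Set M} {f : M × ℝ → ℝ} {Ω : ℝ → FourFormField M}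
    (hf : ContMDiffOn ((𝓡 8).prod 𝓘(ℝ, ℝ)) 𝓘(ℝ, ℝ) ∞ f (U ×ˢ Set.Icc 0 1))
    (hΩ : SmoothFormFamilyOn M U Ω) :
    SmoothFormFamilyOn M U (fun t p => f (p, t) • Ω t p) :=
  fun W hW hWU X hX => (hf.mono (Set.prod_mono_left hWU)).mul (hΩ W hW hWU X hX)

variable [RiemannianBundle (fun p : M => TangentSpace (𝓡 8) p)]

/-- The one-parameter family `A t`, `t ∈ [0,1]`, of fields of endomorphisms is smooth on
`U × [0,1]`, in the sense that its matrix coefficients for smooth vector fields are smooth. -/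
def SmoothEndFamilyOn (U : Set M)
    (A : ℝ → ∀ p : M, TangentSpace (𝓡 8) p →L[ℝ] TangentSpace (𝓡 8) p) : Prop :=
  ∀ W ⊆ U, ∀ X Y : ∀ p : M, TangentSpace (𝓡 8) p, SmoothVectorFieldOn M W X →
    SmoothVectorFieldOn M W Y →
    ContMDiffOn ((𝓡 8).prod 𝓘(ℝ, ℝ)) 𝓘(ℝ, ℝ) ∞
      (fun x : M × ℝ => (inner ℝ (A x.2 x.1 (X x.1)) (Y x.1) : ℝ)) (W ×ˢ Set.Icc (0 : ℝ) 1)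

section

variable {U : Set M} {A B : ℝ → ∀ p : M, TangentSpace (𝓡 8) p →L[ℝ] TangentSpace (𝓡 8) p}

theorem SmoothEndFamilyOn.add (hA : SmoothEndFamilyOn U A) (hB : SmoothEndFamilyOn U B) :
    SmoothEndFamilyOn U (fun t p => A t p + B t p) := fun W hW X Y hX hY =>
  ((hA W hW X Y hX hY).add (hB W hW X Y hX hY)).congr fun _ _ => inner_add_left _ _ _

theorem SmoothEndFamilyOn.smul {f : M × ℝ → ℝ}
    (hf : ContMDiffOn ((𝓡 8).prod 𝓘(ℝ, ℝ)) 𝓘(ℝ, ℝ) ∞ f (U ×ˢ Set.Icc 0 1))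
    (hA : SmoothEndFamilyOn U A) : SmoothEndFamilyOn U (fun t p => f (p, t) • A t p) :=
  fun W hW X Y hX hY =>
    ((hf.mono (Set.prod_mono_left hW)).mul (hA W hW X Y hX hY)).congr
      fun _ _ => real_inner_smul_left _ _ _

theorem smoothFormFamilyOn_hkForm {J : Fin 3 → ℝ → ∀ p : M,
      TangentSpace (𝓡 8) p →L[ℝ] TangentSpace (𝓡 8) p}
    (hs : ∀ i, ∀ t ∈ Set.Icc (0 : ℝ) 1, ∀ p ∈ U, IsSkewEnd (J i t p))
    (hJ : ∀ i, SmoothEndFamilyOn U (J i)) :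
    SmoothFormFamilyOn M U (fun t p => hkForm (fun i => J i t p)) := by
  intro W _ hWU X hX
  have h := fun i k l => hJ i W hWU (X k) (X l) (hX k) (hX l)
  have hw : ∀ i, ContMDiffOn ((𝓡 8).prod 𝓘(ℝ, ℝ)) 𝓘(ℝ, ℝ) ∞
      (fun x : M × ℝ => wedgeTwo (kahlerForm (J i x.2 x.1)) (kahlerForm (J i x.2 x.1))
        (fun k => X k x.1)) (W ×ˢ Set.Icc (0 : ℝ) 1) := fun i =>
    (contMDiffOn_const.mul ((((h i 0 1).mul (h i 2 3)).sub ((h i 0 2).mul (h i 1 3))).add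
      ((h i 0 3).mul (h i 1 2)))).congr fun x hx =>
        wedgeTwo_kahlerForm_apply (hs i x.2 hx.2 x.1 (hWU hx.1)) _
  refine (contMDiffOn_const.mul (((hw 0).add (hw 1)).add (hw 2))).congr (f := fun x => (1 / 6 : ℝ) * _)
    fun x _ => ?_
  simp only [hkForm, Fin.sum_univ_three]
  rfl

end

variable [IsContMDiffRiemannianBundle (𝓡 8) ∞ (EuclideanSpace ℝ (Fin 8))
    (fun p : M => TangentSpace (𝓡 8) p)] {U : Set M}

namespace MapsSmoothFields

variable {A B : ∀ p : M, TangentSpace (𝓡 8) p →L[ℝ] TangentSpace (𝓡 8) p}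

theorem smoothEndFamilyOn (hA : MapsSmoothFields U A) : SmoothEndFamilyOn U (fun _ => A) :=
  fun _ hW _ _ hX hY => ((hA _ hW _ hX).inner hY).comp contMDiffOn_fst fun _ hx => hx.1

theorem endTrace (o : ManifoldOrientation M) (hA : MapsSmoothFields U A) :
    ContMDiffOn (𝓡 8) 𝓘(ℝ, ℝ) ∞ (fun p => _root_.endTrace (A p)) U := by
  refine contMDiffOn_of_locally_contMDiffOn fun p _ => ?_
  obtain ⟨U', hU', hpU', e, he, hb⟩ := o.exists_orthonormal_frame p
  refine ⟨U', hU', hpU', ?_⟩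
  have hi := fun i => ((he i).mono Set.inter_subset_right).inner
    (hA (U ∩ U') Set.inter_subset_left _ ((he i).mono Set.inter_subset_right))
  refine (contMDiffOn_finsetSum (t := Finset.univ) fun i _ => hi i).congr fun p hp => ?_
  obtain ⟨b, hb⟩ := hb p hp.2
  rw [endTrace_eq_sum b]
  simp only [hb]

theorem endInner (o : ManifoldOrientation M) (hA : MapsSmoothFields U A)
    (hB : MapsSmoothFields U B) :
    ContMDiffOn (𝓡 8) 𝓘(ℝ, ℝ) ∞ (fun p => _root_.endInner (A p) (B p)) U :=
  ((contMDiffOn_const (c := (-1 / 8 : ℝ))).mul ((hA.mul hB).endTrace o)).congr fun p _ => by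
    rw [endInner_apply, Pi.mul_apply]; ring

theorem hkProj (o : ManifoldOrientation M)
    {J : Fin 3 → ∀ p : M, TangentSpace (𝓡 8) p →L[ℝ] TangentSpace (𝓡 8) p}
    (hJ : ∀ i, MapsSmoothFields U (J i)) (hA : MapsSmoothFields U A) :
    MapsSmoothFields U (fun p => _root_.hkProj (fun i => J i p) (A p)) :=
  sum_three (fun i => hA.endInner o (hJ i)) hJ

theorem endNormalize (o : ManifoldOrientation M) (hA : MapsSmoothFields U A)
    (hpos : ∀ p ∈ U, 0 < _root_.endInner (A p) (A p)) :
    MapsSmoothFields U (fun p => _root_.endNormalize (A p)) :=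
  smul (contMDiffOn_inv_sqrt (hA.endInner o hA) hpos) hA

end MapsSmoothFields

variable {o : ManifoldOrientation M}

namespace AQHStructure

/-- `formInner` uses an arbitrarily chosen basis at each point; smoothness is visible only after
rewriting it in traces of products of local triples. -/
theorem contMDiff_formInner (Q₀ Q₁ : AQHStructure o) :
    ContMDiffOn (𝓡 8) 𝓘(ℝ, ℝ) ∞
      (fun p => formInner (Q₀.fundamentalForm p) (Q₁.fundamentalForm p)) Set.univ := by
  refine contMDiffOn_of_locally_contMDiffOn fun p _ => ?_
  obtain ⟨U₀, hU₀, hp₀, J, hJ, h⟩ := Q₀.exists_local_triple p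
  obtain ⟨U₁, hU₁, hp₁, J', hJ', h'⟩ := Q₁.exists_local_triple p
  refine ⟨U₀ ∩ U₁, hU₀.inter hU₁, ⟨hp₀, hp₁⟩, ?_⟩
  rw [Set.univ_inter]
  have hm := fun i => (hJ i).mapsSmoothFields.mono (U' := U₀ ∩ U₁) Set.inter_subset_left
  have hm' := fun i => (hJ' i).mapsSmoothFields.mono (U' := U₀ ∩ U₁) Set.inter_subset_right
  have hij := fun i j => (hm i).mul (hm' j)
  refine ((contMDiffOn_const (c := (1 / 36 : ℝ))).mul (contMDiffOn_finsetSum (t := Finset.univ) fun i _ =>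
    contMDiffOn_finsetSum (t := Finset.univ) fun j _ =>
      ((contMDiffOn_const (c := (1 / 2 : ℝ))).mul (((hij i j).endTrace o).pow 2)).sub
        (((hij i j).mul (hij i j)).endTrace o))).congr fun q hq => ?_
  rw [Q₀.fundamentalForm_eq q (h q hq.1).1 (h q hq.1).2,
    Q₁.fundamentalForm_eq q (h' q hq.2).1 (h' q hq.2).2]
  exact formInner_hkForm (fun i => ((h q hq.1).1.complex i).skew)
    fun i => ((h' q hq.2).1.complex i).skew

theorem smoothFormFamilyOn_fundamentalForm (Q : AQHStructure o) :
    SmoothFormFamilyOn M Set.univ (fun _ => Q.fundamentalForm) := by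
  intro W hW _ X hX
  refine contMDiffOn_of_locally_contMDiffOn fun x _ => ?_
  obtain ⟨U, hU, hp, J, hJ, h⟩ := Q.exists_local_triple x.1
  refine ⟨U ×ˢ Set.univ, hU.prod isOpen_univ, ⟨hp, trivial⟩, ?_⟩
  have := smoothFormFamilyOn_hkForm (J := fun i _ => J i)
    (fun i _ _ p hp => ((h p hp).1.complex i).skew)
    (fun i => (hJ i).mapsSmoothFields.smoothEndFamilyOn) (W ∩ U) (hW.inter hU)
    Set.inter_subset_right X fun i => (hX i).mono Set.inter_subset_left
  rw [Set.prod_inter_prod, Set.inter_univ]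
  refine this.congr fun y hy => ?_
  exact congrArg (fun Ω => Ω fun i => X i y.1)
    (Q.fundamentalForm_eq y.1 (h y.1 hy.1.2).1 (h y.1 hy.1.2).2)

end AQHStructure

end Families

/-! ### Norms of fundamental forms and of their convex combinations -/

section FormNorms

variable {V : Type*} [NormedAddCommGroup V] [InnerProductSpace ℝ V] [FiniteDimensional ℝ V]
  {o : Orientation ℝ V (Fin 8)} {J J' : Fin 3 → V →L[ℝ] V}

/-- The common-structure formula with J' = J: the cosines are 1 and 0, and (14 + 16)/9 = 10/3. -/
theorem IsHKTriple.formInner_self (hV : Module.finrank ℝ V = 8) (h : IsHKTriple o J) :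
    formInner (hkForm J) (hkForm J) = 10 / 3 := by
  have h11 := h.endInner_eq hV 1 1
  have h12 := h.endInner_eq hV 1 2
  rw [h.eq_mul] at h12
  rw [h.eq_cons, formInner_hkForm_of_common hV h.isQuatPair h.isQuatPair, h11, h12]
  norm_num [show (1 : Fin 3) ≠ 2 by decide]

/-- The squared norm of a convex combination of the fundamental forms of two triples. -/
theorem IsHKTriple.formInner_segment (hV : Module.finrank ℝ V = 8) (h : IsHKTriple o J)
    (h' : IsHKTriple o J') (t : ℝ) :
    formInner ((1 - t) • hkForm J + t • hkForm J') ((1 - t) • hkForm J + t • hkForm J') =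
      10 / 3 * ((1 - t) ^ 2 + t ^ 2) + 2 * (t * (1 - t)) * formInner (hkForm J) (hkForm J') := by
  simp only [formInner_add_left, formInner_add_right, formInner_smul_left, formInner_smul_right,
    h.formInner_self hV, h'.formInner_self hV, formInner_comm (hkForm J') (hkForm J)]
  ring

end FormNorms

/-! ### The homotopy through self-dual forms of constant norm -/

section SelfDualHomotopy

variable {M : Type*} [TopologicalSpace M] [ChartedSpace (EuclideanSpace ℝ (Fin 8)) M]
  [IsManifold (𝓡 8) ∞ M] [RiemannianBundle (fun p : M => TangentSpace (𝓡 8) p)]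
  {o : ManifoldOrientation M}

namespace AQHStructure

/-- The squared norm of `(1 - t) Ω₀ + t Ω₁`. -/
def segmentNormSq (Q₀ Q₁ : AQHStructure o) (x : M × ℝ) : ℝ :=
  10 / 3 * ((1 - x.2) ^ 2 + x.2 ^ 2) +
    2 * (x.2 * (1 - x.2)) * formInner (Q₀.fundamentalForm x.1) (Q₁.fundamentalForm x.1)

/-- A common complex structure makes `hkCosSq` a squared norm, so the inner product is even at least
14/9. -/
theorem formInner_nonneg {Q₀ Q₁ : AQHStructure o} {p : M}
    (hd : 1 ≤ Module.finrank ℝ ↥(Q₀.E p ⊓ Q₁.E p)) :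
    0 ≤ formInner (Q₀.fundamentalForm p) (Q₁.fundamentalForm p) := by
  obtain ⟨J, h, hJ⟩ := Q₀.exists_triple p
  obtain ⟨J', h', hJ'⟩ := Q₁.exists_triple p
  rw [hJ, hJ'] at hd
  obtain ⟨I, K, c⟩ := exists_isCommonFrame (finrank_tangentSpace_eq p) h h' hd
  have := c.hkCosSq_nonneg (finrank_tangentSpace_eq p)
  rw [hkCosSq] at this
  rw [Q₀.fundamentalForm_eq p h hJ, Q₁.fundamentalForm_eq p h' hJ']
  linarith

theorem segmentNormSq_pos {Q₀ Q₁ : AQHStructure o} {x : M × ℝ}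
    (hd : 1 ≤ Module.finrank ℝ ↥(Q₀.E x.1 ⊓ Q₁.E x.1)) (hx : x.2 ∈ Set.Icc (0 : ℝ) 1) :
    0 < Q₀.segmentNormSq Q₁ x := by
  have h1 := mul_nonneg (mul_nonneg zero_le_two (mul_nonneg hx.1 (sub_nonneg.2 hx.2)))
    (formInner_nonneg hd)
  rw [segmentNormSq]
  -- The mixed term is nonnegative, and (1 - t)² + t² ≥ 1/2.
  nlinarith [sq_nonneg (x.2 - 1 / 2)]

/-- The segment from `Ω₀` to `Ω₁`, rescaled to constant norm. -/
def normalizedSegment (Q₀ Q₁ : AQHStructure o) (t : ℝ) : FourFormField M := fun p =>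
  (√(10 / 3) * (√(Q₀.segmentNormSq Q₁ (p, t)))⁻¹) •
    ((1 - t) • Q₀.fundamentalForm p + t • Q₁.fundamentalForm p)

theorem normalizedSegment_zero (Q₀ Q₁ : AQHStructure o) :
    Q₀.normalizedSegment Q₁ 0 = Q₀.fundamentalForm := by
  funext p
  simp [normalizedSegment, segmentNormSq]

theorem normalizedSegment_one (Q₀ Q₁ : AQHStructure o) :
    Q₀.normalizedSegment Q₁ 1 = Q₁.fundamentalForm := by
  funext p
  simp [normalizedSegment, segmentNormSq]

theorem isSelfDual_normalizedSegment (Q₀ Q₁ : AQHStructure o) (t : ℝ) (p : M) :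
    IsSelfDual (o.or p) (Q₀.normalizedSegment Q₁ t p) := by
  obtain ⟨J, h, hJ⟩ := Q₀.exists_triple p
  obtain ⟨J', h', hJ'⟩ := Q₁.exists_triple p
  rw [normalizedSegment, Q₀.fundamentalForm_eq p h hJ, Q₁.fundamentalForm_eq p h' hJ']
  exact (((h.isSelfDual_hkForm (finrank_tangentSpace_eq p)).smul _).add
    ((h'.isSelfDual_hkForm (finrank_tangentSpace_eq p)).smul _)).smul _

theorem formInner_normalizedSegment {Q₀ Q₁ : AQHStructure o} {t : ℝ} {p : M}
    (hd : 1 ≤ Module.finrank ℝ ↥(Q₀.E p ⊓ Q₁.E p)) (ht : t ∈ Set.Icc (0 : ℝ) 1) :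
    formInner (Q₀.normalizedSegment Q₁ t p) (Q₀.normalizedSegment Q₁ t p) = 10 / 3 := by
  have hpos := segmentNormSq_pos (x := (p, t)) hd ht
  have hn : formInner ((1 - t) • Q₀.fundamentalForm p + t • Q₁.fundamentalForm p)
      ((1 - t) • Q₀.fundamentalForm p + t • Q₁.fundamentalForm p) =
        Q₀.segmentNormSq Q₁ (p, t) := by
    obtain ⟨J, h, hJ⟩ := Q₀.exists_triple p
    obtain ⟨J', h', hJ'⟩ := Q₁.exists_triple p
    rw [segmentNormSq, Q₀.fundamentalForm_eq p h hJ, Q₁.fundamentalForm_eq p h' hJ']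
    exact h.formInner_segment (finrank_tangentSpace_eq p) h' t
  rw [normalizedSegment, formInner_smul_left, formInner_smul_right, hn]
  have e1 := Real.mul_self_sqrt hpos.le
  have e2 := Real.mul_self_sqrt (show (0 : ℝ) ≤ 10 / 3 by norm_num)
  have h0 := Real.sqrt_ne_zero'.2 hpos
  generalize √(Q₀.segmentNormSq Q₁ (p, t)) = r at *
  generalize √(10 / 3) = s at *
  rw [← e1, ← e2]
  field_simp

variable [IsContMDiffRiemannianBundle (𝓡 8) ∞ (EuclideanSpace ℝ (Fin 8))
    (fun p : M => TangentSpace (𝓡 8) p)]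

theorem smoothFormFamilyOn_normalizedSegment {Q₀ Q₁ : AQHStructure o}
    (hd : ∀ p, 1 ≤ Module.finrank ℝ ↥(Q₀.E p ⊓ Q₁.E p)) :
    SmoothFormFamilyOn M Set.univ (Q₀.normalizedSegment Q₁) := by
  have ht : ContMDiffOn ((𝓡 8).prod 𝓘(ℝ, ℝ)) 𝓘(ℝ, ℝ) ∞ (fun x : M × ℝ => x.2)
    (Set.univ ×ˢ Set.Icc 0 1) := contMDiffOn_snd
  have ht' : ContMDiffOn ((𝓡 8).prod 𝓘(ℝ, ℝ)) 𝓘(ℝ, ℝ) ∞ (fun x : M × ℝ => 1 - x.2)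
    (Set.univ ×ˢ Set.Icc 0 1) := contMDiffOn_const.sub ht
  have hF : ContMDiffOn ((𝓡 8).prod 𝓘(ℝ, ℝ)) 𝓘(ℝ, ℝ) ∞
      (fun x : M × ℝ => formInner (Q₀.fundamentalForm x.1) (Q₁.fundamentalForm x.1))
      (Set.univ ×ˢ Set.Icc 0 1) :=
    (Q₀.contMDiff_formInner Q₁).comp contMDiffOn_fst fun _ _ => trivial
  have hn : ContMDiffOn ((𝓡 8).prod 𝓘(ℝ, ℝ)) 𝓘(ℝ, ℝ) ∞ (Q₀.segmentNormSq Q₁)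
      (Set.univ ×ˢ Set.Icc 0 1) :=
    ((contMDiffOn_const (c := (10 / 3 : ℝ))).mul ((ht'.pow 2).add (ht.pow 2))).add
      (((contMDiffOn_const (c := (2 : ℝ))).mul (ht.mul ht')).mul hF)
  exact ((Q₀.smoothFormFamilyOn_fundamentalForm.smul ht').add
    (Q₁.smoothFormFamilyOn_fundamentalForm.smul ht)).smul
      ((contMDiffOn_const (c := √(10 / 3))).mul
        (contMDiffOn_inv_sqrt hn fun x hx => segmentNormSq_pos (hd x.1) hx.2))

end AQHStructure

end SelfDualHomotopy

/-! ### Recovering the common complex structure by projections -/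

section CommonPart

variable {V : Type*} [NormedAddCommGroup V] [InnerProductSpace ℝ V]

/-- For `α` in the span of `J`, a multiple of the common complex structure of the spans of two
hyper-Kähler triples `J` and `J'`. -/
def commonPart [FiniteDimensional ℝ V] (J J' : Fin 3 → V →L[ℝ] V) (α : V →L[ℝ] V) : V →L[ℝ] V :=
  hkProj J (hkProj J' α) - hkCosSq J J' • α

/-- The component of `β` orthogonal to the unit element `I`. -/
def orthPart (I β : V →L[ℝ] V) : V →L[ℝ] V := β - endInner β I • I

variable [FiniteDimensional ℝ V] {o : Orientation ℝ V (Fin 8)} {J J' : Fin 3 → V →L[ℝ] V}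

/-- `commonPart` of α is a multiple of the common unit, so it suffices that it and the
orthogonalized β do not vanish. Both are open conditions, so a frame found at one point extends to a
neighbourhood. -/
theorem IsCommonFrame.of_pos (hV : Module.finrank ℝ V = 8) (h : IsHKTriple o J)
    (h' : IsHKTriple o J') (hd : 1 ≤ Module.finrank ℝ
      ↥(Submodule.span ℝ (Set.range J) ⊓ Submodule.span ℝ (Set.range J')))
    {α β : V →L[ℝ] V} (hα : α ∈ Submodule.span ℝ (Set.range J))
    (hβ : β ∈ Submodule.span ℝ (Set.range J))
    (h1 : 0 < endInner (commonPart J J' α) (commonPart J J' α))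
    (h2 : 0 < endInner (orthPart (endNormalize (commonPart J J' α)) β)
      (orthPart (endNormalize (commonPart J J' α)) β)) :
    IsCommonFrame o J J' (endNormalize (commonPart J J' α))
      (endNormalize (orthPart (endNormalize (commonPart J J' α)) β)) := by
  obtain ⟨I, K, c⟩ := exists_isCommonFrame hV h h' hd
  have e : commonPart J J' α = _ := c.hkProj_hkProj_sub hV hα
  have m : endNormalize (commonPart J J' α) ∈ Submodule.span ℝ (Set.range J) := by
    rw [e]; exact Submodule.smul_mem _ _ (Submodule.smul_mem _ _ c.mem_left)
  have m' : endNormalize (commonPart J J' α) ∈ Submodule.span ℝ (Set.range J') := by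
    rw [e]; exact Submodule.smul_mem _ _ (Submodule.smul_mem _ _ c.mem_right)
  have n := endInner_endNormalize_self h1
  refine ⟨h, h', m, m', Submodule.smul_mem _ _ (Submodule.sub_mem _ hβ (Submodule.smul_mem _ _ m)),
    n, endInner_endNormalize_self h2, ?_⟩
  have z : endInner (endNormalize (commonPart J J' α))
      (orthPart (endNormalize (commonPart J J' α)) β) = 0 := by
    rw [orthPart, map_sub, map_smul, n, endInner_comm _ β, smul_eq_mul, mul_one, sub_self]
  rw [endInner_endNormalize_right, z, mul_zero]

theorem IsCommonFrame.commonPart_eq {I K : V →L[ℝ] V} (c : IsCommonFrame o J J' I K)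
    (hV : Module.finrank ℝ V = 8) : commonPart J J' I = (1 - hkCosSq J J') • I := by
  rw [commonPart, c.hkProj_hkProj_sub hV c.mem_left, c.norm_common, mul_one]

theorem IsCommonFrame.commonPart_pos {I K : V →L[ℝ] V} (c : IsCommonFrame o J J' I K)
    (hV : Module.finrank ℝ V = 8) (hne : hkCosSq J J' ≠ 1) :
    0 < endInner (commonPart J J' I) (commonPart J J' I) := by
  rw [c.commonPart_eq hV]
  simp only [map_smul, LinearMap.smul_apply, c.norm_common, smul_eq_mul, mul_one]
  exact mul_self_pos.2 (sub_ne_zero.2 hne.symm)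

theorem IsCommonFrame.orthPart_eq {I K : V →L[ℝ] V} (c : IsCommonFrame o J J' I K)
    (hV : Module.finrank ℝ V = 8) : orthPart (endNormalize (commonPart J J' I)) K = K := by
  rw [orthPart, endInner_endNormalize_right, c.commonPart_eq hV,
    map_smul (endInner K), endInner_comm K I, c.orth]
  simp

end CommonPart

/-! ### Smooth adapted frames near a point -/

section LocalFrame

variable {M : Type*} [TopologicalSpace M] [ChartedSpace (EuclideanSpace ℝ (Fin 8)) M]

theorem isOpen_inter_pos {U : Set M} (hU : IsOpen U) {f : M → ℝ}
    (hf : ContMDiffOn (𝓡 8) 𝓘(ℝ, ℝ) ∞ f U) : IsOpen (U ∩ {p | 0 < f p}) :=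
  hf.continuousOn.isOpen_inter_preimage hU isOpen_Ioi

variable [IsManifold (𝓡 8) ∞ M] [RiemannianBundle (fun p : M => TangentSpace (𝓡 8) p)]
  [IsContMDiffRiemannianBundle (𝓡 8) ∞ (EuclideanSpace ℝ (Fin 8))
    (fun p : M => TangentSpace (𝓡 8) p)]
  {o : ManifoldOrientation M}

namespace AQHStructure

/-- Near every point, smooth triples of two almost quaternionic Hermitian structures with
one-dimensional intersection come with smooth adapted frames. -/
theorem exists_local_commonFrame {Q₀ Q₁ : AQHStructure o}
    (hd : ∀ p, Module.finrank ℝ ↥(Q₀.E p ⊓ Q₁.E p) = 1) (p₀ : M) :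
    ∃ U : Set M, IsOpen U ∧ p₀ ∈ U ∧
      ∃ (J J' : Fin 3 → ∀ p : M, TangentSpace (𝓡 8) p →L[ℝ] TangentSpace (𝓡 8) p)
        (I K : ∀ p : M, TangentSpace (𝓡 8) p →L[ℝ] TangentSpace (𝓡 8) p),
        (∀ i, MapsSmoothFields U (J' i)) ∧ MapsSmoothFields U I ∧ MapsSmoothFields U K ∧
        ∀ p ∈ U, IsCommonFrame (o.or p) (fun i => J i p) (fun i => J' i p) (I p) (K p) ∧
          Q₀.E p = Submodule.span ℝ (Set.range fun i => J i p) ∧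
          Q₁.E p = Submodule.span ℝ (Set.range fun i => J' i p) := by
  obtain ⟨U₀, hU₀, hp₀, J, hJ, h⟩ := Q₀.exists_local_triple p₀
  obtain ⟨U₁, hU₁, hp₁, J', hJ', h'⟩ := Q₁.exists_local_triple p₀
  have hd' : ∀ p ∈ U₀ ∩ U₁, Module.finrank ℝ
      ↥(Submodule.span ℝ (Set.range fun i => J i p) ⊓
        Submodule.span ℝ (Set.range fun i => J' i p)) = 1 := fun p hp => by
    rw [← (h p hp.1).2, ← (h' p hp.2).2]; exact hd p
  have hm := fun i => (hJ i).mapsSmoothFields.mono (U' := U₀ ∩ U₁) Set.inter_subset_left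
  have hm' := fun i => (hJ' i).mapsSmoothFields.mono (U' := U₀ ∩ U₁) Set.inter_subset_right
  obtain ⟨I₀, K₀, c⟩ := exists_isCommonFrame (finrank_tangentSpace_eq p₀) (h p₀ hp₀).1
    (h' p₀ hp₁).1 (hd' p₀ ⟨hp₀, hp₁⟩).ge
  obtain ⟨u, hu⟩ := (Submodule.mem_span_range_iff_exists_fun ℝ).1 c.mem_left
  obtain ⟨w, hw⟩ := (Submodule.mem_span_range_iff_exists_fun ℝ).1 c.mem
  -- The frame I₀, K₀ found at p₀ is extended with constant coefficients in the local triple; α and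
  -- β need not be adapted away from p₀.
  let α : ∀ p : M, TangentSpace (𝓡 8) p →L[ℝ] TangentSpace (𝓡 8) p := fun p => ∑ i, u i • J i p
  let β : ∀ p : M, TangentSpace (𝓡 8) p →L[ℝ] TangentSpace (𝓡 8) p := fun p => ∑ i, w i • J i p
  have hα : MapsSmoothFields (U₀ ∩ U₁) α := .sum_three (fun _ => contMDiffOn_const) hm
  have hβ : MapsSmoothFields (U₀ ∩ U₁) β := .sum_three (fun _ => contMDiffOn_const) hm
  have hcos : ContMDiffOn (𝓡 8) 𝓘(ℝ, ℝ) ∞ (fun p => hkCosSq (fun i => J i p) (fun i => J' i p))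
      (U₀ ∩ U₁) := by
    refine ((contMDiffOn_const (c := (1 / 16 : ℝ))).mul (((contMDiffOn_const (c := (9 : ℝ))).mul
      ((Q₀.contMDiff_formInner Q₁).mono (Set.subset_univ _))).sub
        (contMDiffOn_const (c := (14 : ℝ))))).congr fun p hp => ?_
    rw [hkCosSq, ← Q₀.fundamentalForm_eq p (h p hp.1).1 (h p hp.1).2,
      ← Q₁.fundamentalForm_eq p (h' p hp.2).1 (h' p hp.2).2]
    simp only [Pi.mul_apply]
    ring
  let δ : ∀ p : M, TangentSpace (𝓡 8) p →L[ℝ] TangentSpace (𝓡 8) p := fun p =>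
    commonPart (fun i => J i p) (fun i => J' i p) (α p)
  have hδ : MapsSmoothFields (U₀ ∩ U₁) δ :=
    ((hα.hkProj o hm').hkProj o hm).sub (.smul hcos hα)
  have hU₂ := isOpen_inter_pos (hU₀.inter hU₁) (hδ.endInner o hδ)
  set U₂ := U₀ ∩ U₁ ∩ {p | 0 < endInner (δ p) (δ p)}
  have hI : MapsSmoothFields U₂ (fun p => endNormalize (δ p)) :=
    (hδ.mono Set.inter_subset_left).endNormalize o fun p hp => hp.2
  let κ : ∀ p : M, TangentSpace (𝓡 8) p →L[ℝ] TangentSpace (𝓡 8) p := fun p =>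
    orthPart (endNormalize (δ p)) (β p)
  have hβ₂ := hβ.mono (U' := U₂) Set.inter_subset_left
  have hκ : MapsSmoothFields U₂ κ := hβ₂.sub (.smul (hβ₂.endInner o hI) hI)
  have hU₃ := isOpen_inter_pos hU₂ (hκ.endInner o hκ)
  set U₃ := U₂ ∩ {p | 0 < endInner (κ p) (κ p)}
  -- At p₀, δ is (1 - `hkCosSq`) I₀, nonzero because the intersection is exactly one-dimensional.
  have hδ₀ : 0 < endInner (δ p₀) (δ p₀) := by
    have := c.commonPart_pos (finrank_tangentSpace_eq p₀)
      (c.hkCosSq_ne_one (finrank_tangentSpace_eq p₀) (hd' p₀ ⟨hp₀, hp₁⟩))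
    rwa [← hu] at this
  have hκ₀ : 0 < endInner (κ p₀) (κ p₀) := by
    have : κ p₀ = K₀ := by
      have := c.orthPart_eq (finrank_tangentSpace_eq p₀)
      rw [← hu, ← hw] at this
      exact this.trans hw
    rw [this, c.norm]
    exact one_pos
  refine ⟨U₃, hU₃, ⟨⟨⟨hp₀, hp₁⟩, hδ₀⟩, hκ₀⟩, J, J', fun p => endNormalize (δ p),
    fun p => endNormalize (κ p), fun i => (hm' i).mono fun p hp => hp.1.1,
    hI.mono Set.inter_subset_left,
    (hκ.mono Set.inter_subset_left).endNormalize o fun p hp => hp.2, fun p hp => ⟨?_, ?_, ?_⟩⟩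
  · have hp' := hp.1.1
    exact IsCommonFrame.of_pos (finrank_tangentSpace_eq p) (h p hp'.1).1 (h' p hp'.2).1
      (hd' p hp').ge
      (Submodule.sum_mem _ fun i _ => Submodule.smul_mem _ _ (Submodule.subset_span ⟨i, rfl⟩))
      (Submodule.sum_mem _ fun i _ => Submodule.smul_mem _ _ (Submodule.subset_span ⟨i, rfl⟩))
      hp.1.2 hp.2
  · exact (h p hp.1.1.1).2
  · exact (h' p hp.1.1.2).2

end AQHStructure

end LocalFrame

/-! ### The local homotopy through fundamental forms -/

section LocalHomotopy

variable {M : Type*} [TopologicalSpace M] [ChartedSpace (EuclideanSpace ℝ (Fin 8)) M]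
  [IsManifold (𝓡 8) ∞ M] [RiemannianBundle (fun p : M => TangentSpace (𝓡 8) p)]
  {o : ManifoldOrientation M}

/-- The bound is the value at which `hkCosSq` vanishes: 7/15 = (3/10)(14/9). -/
theorem AQHStructure.hkCosSq_pos {Q₀ Q₁ : AQHStructure o} {p : M}
    (hc : 7 / 15 < Real.cos (Q₀.angle Q₁ p))
    {J J' : Fin 3 → TangentSpace (𝓡 8) p →L[ℝ] TangentSpace (𝓡 8) p}
    (h : IsHKTriple (o.or p) J) (hJ : Q₀.E p = Submodule.span ℝ (Set.range J))
    (h' : IsHKTriple (o.or p) J') (hJ' : Q₁.E p = Submodule.span ℝ (Set.range J')) :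
    0 < hkCosSq J J' := by
  rw [angle, Q₀.fundamentalForm_eq p h hJ, Q₁.fundamentalForm_eq p h' hJ'] at hc
  rw [hkCosSq]
  -- `Real.arccos` is constant outside [-1, 1]. Below -1 the cosine would be -1, against `hc`; above
  -- 1 the claim is immediate, so no Cauchy-Schwarz bound is needed.
  rcases le_or_gt (3 / 10 * formInner (hkForm J) (hkForm J')) (-1) with hle | hgt
  · rw [Real.arccos_of_le_neg_one hle, Real.cos_pi] at hc
    norm_num at hc
  rcases le_or_gt (3 / 10 * formInner (hkForm J) (hkForm J')) 1 with hle | hgt'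
  · rw [Real.cos_arccos hgt.le hle] at hc
    linarith
  · linarith

variable [IsContMDiffRiemannianBundle (𝓡 8) ∞ (EuclideanSpace ℝ (Fin 8))
    (fun p : M => TangentSpace (𝓡 8) p)] {U : Set M}
  {A B : ∀ p : M, TangentSpace (𝓡 8) p →L[ℝ] TangentSpace (𝓡 8) p}

theorem MapsSmoothFields.segment (hA : MapsSmoothFields U A) (hB : MapsSmoothFields U B) :
    SmoothEndFamilyOn U (fun t p => (1 - t) • A p + t • B p) :=
  (SmoothEndFamilyOn.smul (A := fun _ => A) (f := fun x => 1 - x.2)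
    (contMDiffOn_const.sub contMDiffOn_snd) hA.smoothEndFamilyOn).add
      (SmoothEndFamilyOn.smul (A := fun _ => B) (f := fun x => x.2) contMDiffOn_snd
        hB.smoothEndFamilyOn)

theorem MapsSmoothFields.endInner_segment (o : ManifoldOrientation M) (hA : MapsSmoothFields U A)
    (hB : MapsSmoothFields U B) :
    ContMDiffOn ((𝓡 8).prod 𝓘(ℝ, ℝ)) 𝓘(ℝ, ℝ) ∞ (fun x : M × ℝ =>
      _root_.endInner ((1 - x.2) • A x.1 + x.2 • B x.1) ((1 - x.2) • A x.1 + x.2 • B x.1))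
      (U ×ˢ Set.Icc (0 : ℝ) 1) := by
  have ht : ContMDiffOn ((𝓡 8).prod 𝓘(ℝ, ℝ)) 𝓘(ℝ, ℝ) ∞ (fun x : M × ℝ => x.2)
    (U ×ˢ Set.Icc 0 1) := contMDiffOn_snd
  have ht' : ContMDiffOn ((𝓡 8).prod 𝓘(ℝ, ℝ)) 𝓘(ℝ, ℝ) ∞ (fun x : M × ℝ => 1 - x.2)
    (U ×ˢ Set.Icc 0 1) := contMDiffOn_const.sub ht
  have hf : ∀ {f : M → ℝ}, ContMDiffOn (𝓡 8) 𝓘(ℝ, ℝ) ∞ f U →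
      ContMDiffOn ((𝓡 8).prod 𝓘(ℝ, ℝ)) 𝓘(ℝ, ℝ) ∞ (fun x : M × ℝ => f x.1)
        (U ×ˢ Set.Icc 0 1) := fun h => h.comp contMDiffOn_fst fun _ hx => hx.1
  refine (((ht'.mul ht').mul (hf (hA.endInner o hA))).add
    (((contMDiffOn_const (c := (2 : ℝ))).mul (ht.mul ht')).mul (hf (hA.endInner o hB)))).add
      ((ht.mul ht).mul (hf (hB.endInner o hB))) |>.congr fun x _ => ?_
  change _ = (1 - x.2) * (1 - x.2) * _root_.endInner (A x.1) (A x.1) +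
    2 * (x.2 * (1 - x.2)) * _root_.endInner (A x.1) (B x.1) +
      x.2 * x.2 * _root_.endInner (B x.1) (B x.1)
  simp only [map_add, map_smul, LinearMap.add_apply, LinearMap.smul_apply, smul_eq_mul,
    endInner_comm (B x.1) (A x.1)]
  ring

namespace AQHStructure

theorem exists_local_homotopy {Q₀ Q₁ : AQHStructure o}
    (hd : ∀ p, Module.finrank ℝ ↥(Q₀.E p ⊓ Q₁.E p) = 1)
    (hc : ∀ p, 7 / 15 < Real.cos (Q₀.angle Q₁ p)) (p₀ : M) :
    ∃ U : Set M, IsOpen U ∧ p₀ ∈ U ∧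
      ∃ Ω : ℝ → FourFormField M, SmoothFormFamilyOn M U Ω ∧
        (∀ p ∈ U, Ω 0 p = Q₀.fundamentalForm p ∧ Ω 1 p = Q₁.fundamentalForm p) ∧
        ∀ t ∈ Set.Icc (0 : ℝ) 1, ∀ p ∈ U, Ω t p ∈ hkForms (o.or p) := by
  obtain ⟨U, hU, hp₀, J, J', I, K, hJ', hI, hK, hcf⟩ := exists_local_commonFrame hd p₀
  have hpos : ∀ p ∈ U, 0 < hkCosSq (fun i => J i p) (fun i => J' i p) := fun p hp =>
    hkCosSq_pos (hc p) (hcf p hp).1.left (hcf p hp).2.1 (hcf p hp).1.right (hcf p hp).2.2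
  let R : ∀ p : M, TangentSpace (𝓡 8) p →L[ℝ] TangentSpace (𝓡 8) p :=
    fun p => hkProj (fun i => J' i p) (K p)
  have hR : ∀ p ∈ U, 0 < endInner (R p) (R p) := fun p hp =>
    ((hcf p hp).1.endInner_hkProj_self (finrank_tangentSpace_eq p)).symm ▸ hpos p hp
  have hL : MapsSmoothFields U (fun p => endNormalize (R p)) := (hK.hkProj o hJ').endNormalize o hR
  let γ : ℝ → ∀ p : M, TangentSpace (𝓡 8) p →L[ℝ] TangentSpace (𝓡 8) p :=
    fun t p => (1 - t) • K p + t • endNormalize (R p)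
  have hpath := fun t (ht : t ∈ Set.Icc (0 : ℝ) 1) p hp =>
    (hcf p hp).1.path (finrank_tangentSpace_eq p) (hpos p hp) ht (γ := γ t p) rfl
  have hν := contMDiffOn_inv_sqrt (hK.endInner_segment o hL)
    fun x hx => (hpath x.2 hx.2 x.1 hx.1).1
  refine ⟨U, hU, hp₀, fun t p => hkForm ![I p, endNormalize (γ t p), I p * endNormalize (γ t p)],
    ?_, fun p hp => ⟨?_, ?_⟩, fun t ht p hp => ⟨_, (hpath t ht p hp).2, rfl⟩⟩
  · refine smoothFormFamilyOn_hkForm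
      (J := fun i t p => ![I p, endNormalize (γ t p), I p * endNormalize (γ t p)] i)
      (fun i t ht p hp => ((hpath t ht p hp).2.complex i).skew) fun i => ?_
    fin_cases i
    · exact hI.smoothEndFamilyOn
    · exact SmoothEndFamilyOn.smul hν (hK.segment hL)
    -- The third structure is the segment from IK to IL divided by the norm of γ, so it is smooth
    -- for the same reason as the second.
    · have := SmoothEndFamilyOn.smul hν ((hI.mul hK).segment (hI.mul hL))
      convert this using 3 with t p
      exact (mul_smul_comm _ _ _).trans (by rw [mul_add, mul_smul_comm, mul_smul_comm])
  · have c := (hcf p hp).1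
    have : endNormalize (γ 0 p) = K p := by simp [γ, endNormalize, c.norm]
    beta_reduce
    rw [Q₀.fundamentalForm_eq p c.left (hcf p hp).2.1, this]
    exact c.hkForm_left (finrank_tangentSpace_eq p)
  · have c := (hcf p hp).1
    have : endNormalize (γ 1 p) = endNormalize (R p) := by
      have h1 := endInner_endNormalize_self (hR p hp)
      rw [endNormalize]
      simp [γ, h1]
    beta_reduce
    rw [Q₁.fundamentalForm_eq p c.right (hcf p hp).2.2, this]
    exact c.hkForm_right (finrank_tangentSpace_eq p) (hpos p hp)

end AQHStructure

end LocalHomotopy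

end

theorem proposition11p3 {M : Type*} [TopologicalSpace M]
    [ChartedSpace (EuclideanSpace ℝ (Fin 8)) M] [IsManifold (𝓡 8) ∞ M]
    [RiemannianBundle (fun p : M => TangentSpace (𝓡 8) p)]
    [IsContMDiffRiemannianBundle (𝓡 8) ∞ (EuclideanSpace ℝ (Fin 8))
      (fun p : M => TangentSpace (𝓡 8) p)]
    (o : ManifoldOrientation M) (Q₀ Q₁ : AQHStructure o) :
    ((∀ p : M, 1 ≤ Module.finrank ℝ ↥(Q₀.E p ⊓ Q₁.E p)) →
      ∃ Ω : ℝ → FourFormField M, SmoothFormFamilyOn M Set.univ Ω ∧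
        Ω 0 = Q₀.fundamentalForm ∧ Ω 1 = Q₁.fundamentalForm ∧
        ∀ t ∈ Set.Icc (0 : ℝ) 1, ∀ p : M, IsSelfDual (o.or p) (Ω t p) ∧
          formInner (Ω t p) (Ω t p) = 10 / 3) ∧
    ((∀ p : M, Module.finrank ℝ ↥(Q₀.E p ⊓ Q₁.E p) = 1) →
      (∀ p : M, 7 / 15 < Real.cos (Q₀.angle Q₁ p)) →
      ∀ p₀ : M, ∃ U : Set M, IsOpen U ∧ p₀ ∈ U ∧
        ∃ Ω : ℝ → FourFormField M, SmoothFormFamilyOn M U Ω ∧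
          (∀ p ∈ U, Ω 0 p = Q₀.fundamentalForm p ∧ Ω 1 p = Q₁.fundamentalForm p) ∧
          ∀ t ∈ Set.Icc (0 : ℝ) 1, ∀ p ∈ U, Ω t p ∈ hkForms (o.or p)) := by
  refine ⟨fun hd => ⟨Q₀.normalizedSegment Q₁, AQHStructure.smoothFormFamilyOn_normalizedSegment hd,
    Q₀.normalizedSegment_zero Q₁, Q₀.normalizedSegment_one Q₁, fun t ht p =>
      ⟨Q₀.isSelfDual_normalizedSegment Q₁ t p,
        AQHStructure.formInner_normalizedSegment (hd p) ht⟩⟩,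
    fun hd hc p₀ => AQHStructure.exists_local_homotopy hd hc p₀⟩
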